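/- Let $\mathbb K$ be a field, let $t\ge 1$ and $k\ge 2$ be integers, and put $n:=t(k-1)+2$. Let ${\rm GA}(t,k)'$ be the graph with vertex set $\{0,1,\dots,n-1\}$ (identified with $\mathbb Z_n$) in which, for $0\le i<j<n$, the pair $\{i,j\}$ is an edge if and only if $j-i\equiv 1 \pmod t$ and $j-i\notin\{1,n-1\}$. (Equivalently, it is the Cayley graph of $\mathbb Z_n$ with connection set $\{1+jt \mid 1\le j\le k-2\}$.) Let $W$ be a proper induced subgraph of ${\rm GA}(t,k)'$, and let $0\le x_1<x_2<\dots<x_m<n$ be the vertices of ${\rm GA}(t,k)'$ that do not belong to $W$. The intervals of $W$ are the $m$ sets $\{v \mid x_i<v<x_{i+1}\}$ for $1\le i\le m-1$, together with $\{v \mid v>x_m\}\cup\{v \mid v<x_1\}$; the length of an interval is its number of elements. The independence complex $\Delta(W)$ is the simplicial complex whose faces are the independent sets of vertices of $W$ (including $\emptyset$), and $\widetilde H_j(\Delta(W))$ denotes its reduced simplicial homology with coefficients in $\mathbb K$. Suppose that exactly $\ell$ of the intervals of $W$ have length at least $t$, where $\ell\ge 1$. Then $$\widetilde H_j(\Delta(W))\cong\begin{cases}\mathbb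 K^{\ell-1} & \text{if } j=t-1,\\ 0 & \text{otherwise,}\end{cases}$$ where $\mathbb K^0=0$. -/

import Mathlib

/-- The graph `GA(t,k)'`: the vertices are the residues `0, 1, …, n - 1` with `n = t(k-1)+2`, and for
`i < j` the pair `{i, j}` is an edge if and only if `j - i ≡ 1 (mod t)` and `j - i ∉ {1, n - 1}`. -/
def generalizedAndrasfaiPrime (t k : ℕ) : SimpleGraph (Fin (t * (k - 1) + 2)) :=
  SimpleGraph.fromRel fun i j =>
    i < j ∧ (j : ℕ) - (i : ℕ) ≡ 1 [MOD t] ∧ (j : ℕ) - (i : ℕ) ≠ 1 ∧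
      (j : ℕ) - (i : ℕ) ≠ (t * (k - 1) + 2) - 1

/-- The independence complex of a graph. In Mathlib the empty face of a simplicial complex is left
implicit, so the faces listed here are the nonempty finite independent sets of vertices. -/
def independenceComplex {V : Type*} (G : SimpleGraph V) : AbstractSimplicialComplex V where
  faces := {σ | σ.Nonempty ∧ G.IsIndepSet (σ : Set V)}
  isRelLowerSet_faces := fun _ hσ =>
    ⟨hσ.1, fun _ hτσ hτ => ⟨hτ, hσ.2.mono (Finset.coe_subset.2 hτσ)⟩⟩
  singleton_mem := fun v => ⟨Finset.singleton_nonempty v, by simp [SimpleGraph.IsIndepSet]⟩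

/-- The faces of dimension `j` of a simplicial complex, i.e. those with `j + 1` vertices, for `j : ℤ`.
The empty set is a face, of dimension `-1`. -/
abbrev FaceOfDim {V : Type*} (Δ : PreAbstractSimplicialComplex V) (j : ℤ) : Type _ :=
  {σ : Finset V // (σ = ∅ ∨ σ ∈ Δ.faces) ∧ (σ.card : ℤ) = j + 1}

section ReducedHomology

/-- Removing a vertex from a face gives a face. -/
theorem isFace_erase {V : Type*} [DecidableEq V] (Δ : PreAbstractSimplicialComplex V)
    {σ : Finset V} (hσ : σ = ∅ ∨ σ ∈ Δ.faces) (v : V) :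
    σ.erase v = ∅ ∨ σ.erase v ∈ Δ.faces := by
  rcases hσ with rfl | hσ
  · left; simp
  · rcases (σ.erase v).eq_empty_or_nonempty with h | h
    · exact Or.inl h
    · exact Or.inr ((Δ.isRelLowerSet_faces hσ).2 (Finset.erase_subset v σ) h)

/-- The sign of the facet `σ \ {v}` in the boundary of `σ`: it is `(-1)^i`, where `i` is the position
(counted from `0`) of `v` in the increasing list of the vertices of `σ`. -/
def faceSign {V : Type*} [LinearOrder V] (σ : Finset V) (v : V) : ℤ :=
  (-1) ^ (σ.filter (fun w => w < v)).card

/-- The boundary map `C_i → C_j` of the reduced (augmented) chain complex with coefficients in `K`: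
`σ ↦ ∑_{v ∈ σ} ± (σ \ {v})` if `j + 1 = i`, and zero otherwise. -/
noncomputable def reducedBoundary (K : Type*) [Field K] {V : Type*} [LinearOrder V]
    (Δ : PreAbstractSimplicialComplex V) (i j : ℤ) :
    (FaceOfDim Δ i →₀ K) →ₗ[K] (FaceOfDim Δ j →₀ K) :=
  Finsupp.linearCombination K fun σ : FaceOfDim Δ i =>
    ∑ v ∈ σ.1, if h : ((σ.1.erase v).card : ℤ) = j + 1 then
      Finsupp.single (⟨σ.1.erase v, isFace_erase Δ σ.2.1 v, h⟩ : FaceOfDim Δ j)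
        ((faceSign σ.1 v : ℤ) : K)
    else 0

theorem reducedBoundary_shape (K : Type*) [Field K] {V : Type*} [LinearOrder V]
    (Δ : PreAbstractSimplicialComplex V) (i j : ℤ) (hij : j + 1 ≠ i) :
    reducedBoundary K Δ i j = 0 := by
  apply Finsupp.lhom_ext'
  intro σ
  ext1
  simp only [reducedBoundary, LinearMap.comp_apply, Finsupp.lsingle_apply,
    Finsupp.linearCombination_single, one_smul, LinearMap.zero_apply]
  apply Finset.sum_eq_zero
  intro v hv
  have h1 := Finset.card_erase_add_one hv
  have h2 := σ.2.2
  rw [dif_neg]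
  omega

theorem faceSign_swap {V : Type*} [LinearOrder V] {σ : Finset V} {v w : V} (hv : v ∈ σ)
    (hvw : v < w) :
    faceSign σ v * faceSign (σ.erase v) w + faceSign σ w * faceSign (σ.erase w) v = 0 := by
  have h1 : (σ.erase w).filter (fun x => x < v) = σ.filter (fun x => x < v) := by
    ext x
    simp only [Finset.mem_filter, Finset.mem_erase]
    constructor
    · rintro ⟨⟨_, h⟩, h'⟩; exact ⟨h, h'⟩
    · rintro ⟨h, h'⟩; exact ⟨⟨(h'.trans hvw).ne, h⟩, h'⟩
  have h2 : (σ.erase v).filter (fun x => x < w) = (σ.filter (fun x => x < w)).erase v := by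
    ext x
    simp only [Finset.mem_filter, Finset.mem_erase]
    tauto
  have h3 : ((σ.filter (fun x => x < w)).erase v).card + 1 = (σ.filter (fun x => x < w)).card :=
    Finset.card_erase_add_one (by simp [hv, hvw])
  unfold faceSign
  rw [h1, h2, ← h3, pow_succ]
  ring

theorem reducedBoundary_comp (K : Type*) [Field K] {V : Type*} [LinearOrder V]
    (Δ : PreAbstractSimplicialComplex V) (i j l : ℤ) :
    reducedBoundary K Δ j l ∘ₗ reducedBoundary K Δ i j = 0 := by
  by_cases hij : j + 1 = i
  swap
  · rw [reducedBoundary_shape K Δ i j hij, LinearMap.comp_zero]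
  by_cases hjl : l + 1 = j
  swap
  · rw [reducedBoundary_shape K Δ j l hjl, LinearMap.zero_comp]
  apply Finsupp.lhom_ext'
  intro σ
  ext1
  have hc : ∀ v ∈ σ.1, ((σ.1.erase v).card : ℤ) = j + 1 := by
    intro v hv
    have h1 := Finset.card_erase_add_one hv
    have h2 := σ.2.2
    omega
  have hc2 : ∀ v ∈ σ.1, ∀ w ∈ σ.1.erase v, (((σ.1.erase v).erase w).card : ℤ) = l + 1 := by
    intro v hv w hw
    have h1 := Finset.card_erase_add_one hw
    have h2 := hc v hv
    omega
  classical
  -- the iterated boundary as a sum over pairs of vertices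
  have key : reducedBoundary K Δ j l (reducedBoundary K Δ i j (Finsupp.single σ 1)) =
      ∑ p ∈ (σ.1.sigma fun v => σ.1.erase v),
        if h : (((σ.1.erase p.1).erase p.2).card : ℤ) = l + 1 then
          Finsupp.single (⟨(σ.1.erase p.1).erase p.2,
            isFace_erase Δ (isFace_erase Δ σ.2.1 p.1) p.2, h⟩ : FaceOfDim Δ l)
            ((faceSign σ.1 p.1 * faceSign (σ.1.erase p.1) p.2 : ℤ) : K)
        else 0 := by
    rw [Finset.sum_sigma]
    simp only [reducedBoundary, Finsupp.linearCombination_single, one_smul, map_sum]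
    refine Finset.sum_congr rfl fun v hv => ?_
    rw [dif_pos (hc v hv), Finsupp.linearCombination_single, Finset.smul_sum]
    refine Finset.sum_congr rfl fun w hw => ?_
    rw [dif_pos (hc2 v hv w hw), dif_pos (hc2 v hv w hw), Finsupp.smul_single, smul_eq_mul]
    push_cast
    rfl
  simp only [LinearMap.comp_apply, Finsupp.lsingle_apply, LinearMap.zero_apply]
  rw [key]
  refine Finset.sum_involution (fun p _ => ⟨p.2, p.1⟩) ?_ ?_ ?_ ?_
  · rintro ⟨v, w⟩ hp
    obtain ⟨hv, hw⟩ := Finset.mem_sigma.1 hp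
    have hw' := Finset.mem_erase.1 hw
    have hv' : v ∈ σ.1.erase w := Finset.mem_erase.2 ⟨hw'.1.symm, hv⟩
    dsimp only at *
    rw [dif_pos (hc2 v hv w hw), dif_pos (hc2 w hw'.2 v hv')]
    have he : (⟨(σ.1.erase w).erase v, isFace_erase Δ (isFace_erase Δ σ.2.1 w) v,
        hc2 w hw'.2 v hv'⟩ : FaceOfDim Δ l) = ⟨(σ.1.erase v).erase w,
        isFace_erase Δ (isFace_erase Δ σ.2.1 v) w, hc2 v hv w hw⟩ :=
      Subtype.ext Finset.erase_right_comm
    rw [he, ← Finsupp.single_add, ← Int.cast_add]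
    have hz : faceSign σ.1 v * faceSign (σ.1.erase v) w
        + faceSign σ.1 w * faceSign (σ.1.erase w) v = 0 := by
      rcases lt_or_gt_of_ne hw'.1 with h | h
      · rw [add_comm]; exact faceSign_swap hw'.2 h
      · exact faceSign_swap hv h
    rw [hz, Int.cast_zero, Finsupp.single_zero]
  · rintro ⟨v, w⟩ hp _ h
    obtain ⟨hv, hw⟩ := Finset.mem_sigma.1 hp
    have h' : w = v := congrArg Sigma.fst h
    exact (Finset.mem_erase.1 hw).1 h'
  · rintro ⟨v, w⟩ hp
    obtain ⟨hv, hw⟩ := Finset.mem_sigma.1 hp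
    have hw' := Finset.mem_erase.1 hw
    exact Finset.mem_sigma.2 ⟨hw'.2, Finset.mem_erase.2 ⟨hw'.1.symm, hv⟩⟩
  · rintro ⟨v, w⟩ _
    rfl

/-- The reduced (augmented) oriented chain complex of a simplicial complex with coefficients in `K`.
It is indexed by `ℤ`; the chain group in degree `j` has the faces of dimension `j` as a basis. -/
noncomputable def reducedChainComplex (K : Type*) [Field K] {V : Type*} [LinearOrder V]
    (Δ : PreAbstractSimplicialComplex V) : ChainComplex (ModuleCat K) ℤ where
  X j := ModuleCat.of K (FaceOfDim Δ j →₀ K)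
  d i j := ModuleCat.ofHom (reducedBoundary K Δ i j)
  shape i j hij := by
    rw [reducedBoundary_shape K Δ i j hij]
    rfl
  d_comp_d' i j l _ _ := by
    rw [← ModuleCat.ofHom_comp, reducedBoundary_comp]
    rfl

/-- The reduced homology `H̃_j(Δ; K)`, for `j : ℤ`. -/
noncomputable def reducedHomology (K : Type*) [Field K] {V : Type*} [LinearOrder V]
    (Δ : PreAbstractSimplicialComplex V) (j : ℤ) : ModuleCat K :=
  (reducedChainComplex K Δ).homology j

end ReducedHomology

/-- Let `S ⊆ {0, …, n-1}` with complement `{x₁ < ⋯ < x_m}`, and let `x = x_i` be in the complement.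
This is the interval between `x` and the next vertex of the complement: for `i < m` it consists of the
`v` with `x_i < v < x_{i+1}`, and for `i = m` of the `v` with `v > x_m` or `v < x₁`. -/
def intervalAfter {n : ℕ} (S : Finset (Fin n)) (x : Fin n) : Finset (Fin n) :=
  if ∃ y ∉ S, x < y then
    Finset.univ.filter fun v => x < v ∧ ∀ y ∉ S, x < y → v < y
  else
    Finset.univ.filter fun v => x < v ∨ ∀ y ∉ S, v < y

/-- The number of intervals of length at least `t` of the induced subgraph with vertex set `S`; there
is one interval for each vertex of the complement of `S`. -/
def numLongIntervals {n : ℕ} (t : ℕ) (S : Finset (Fin n)) : ℕ :=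
  (Sᶜ.filter fun x => t ≤ (intervalAfter S x).card).card

/-! Choose a missing vertex x followed by a long interval and cut the cycle there. Since t divides n
- 2, the differences d and n - d are congruent to 1 mod t together, so adjacency is invariant under
rotation. On the positions 0 < s < n counted from x the graph becomes `stepGraph t` on integers,
with no wrap-around, and the intervals become the maximal runs of a finite set A whose first run is
long.

The homology of A is found by deleting vertices. The complex of A is that of A \ {v} with a cone
attached over the complex of A \ N[v]; if the homology of these two sits in degrees d + 1 and d, the
dimensions add (`homologyConcentrated_split`). If v has a non-neighbour u with N(u) ⊆ N(v), the link
is a cone and v can be dropped (`SphericalSplitting.fold`).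

The induction is `sphericalSplitting_of_first_run`. The end of a run whose length is not t, beyond
the first t positions, is dropped by folding, which preserves the number of long runs. Once only
runs of length exactly t remain, the link of the largest element has the homology of a (t-2)-sphere
(`sphericalSplitting_link`), so deleting that element destroys one long run and lowers the dimension
in degree t - 1 by one. A single run of length t is independent, hence a simplex, and contributes
nothing; this is the origin of ℓ - 1.

`SphericalSplitting` records the recursion without reference to a field or a vertex order, so the
computation on ℤ can be carried over to the cyclic graph. -/

/-! ### Contraction and cone operators on chains in one ambient space -/

section SimplicialChains

variable {K : Type*} [Field K] {V : Type*}

/-- The chains of dimension `j` of the independence complex of the subgraph of `G` induced by `S`. -/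
def indepChains (K : Type*) [Field K] (G : SimpleGraph V) (S : Finset V) (j : ℤ) :
    Submodule K (Finset V → K) where
  carrier := {x | ∀ τ, x τ ≠ 0 → τ ⊆ S ∧ G.IsIndepSet (τ : Set V) ∧ (τ.card : ℤ) = j + 1}
  zero_mem' := fun τ h => absurd rfl h
  add_mem' := fun {x y} hx hy τ h => by
    by_cases h0 : x τ = 0
    · exact hy τ fun h1 => h (by simp [h0, h1])
    · exact hx τ h0
  smul_mem' := fun c x hx τ h => hx τ fun h0 => h (by simp [h0])

theorem indepChains_mono {G : SimpleGraph V} {S S' : Finset V} {j : ℤ} (h : S ⊆ S') :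
    indepChains K G S j ≤ indepChains K G S' j :=
  fun _ hx τ hτ => ⟨(hx τ hτ).1.trans h, (hx τ hτ).2⟩

theorem notMem_of_link {G : SimpleGraph V} {S L : Finset V} {v : V}
    (hL : ∀ w, w ∈ L ↔ w ∈ S ∧ w ≠ v ∧ ¬ G.Adj v w) : v ∉ L :=
  fun h => ((hL v).1 h).2.1 rfl

variable [LinearOrder V]

/-- Contraction by the vertex `v`: on basis elements, `σ ↦ ± (σ \ {v})` if `v ∈ σ` and `σ ↦ 0`
otherwise. -/
def contractVertex (K : Type*) [Field K] (v : V) : (Finset V → K) →ₗ[K] (Finset V → K) where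
  toFun x τ := if v ∈ τ then 0 else (faceSign τ v : K) * x (insert v τ)
  map_add' x y := by
    ext τ
    simp only [Pi.add_apply]
    split_ifs <;> ring
  map_smul' c x := by
    ext τ
    simp only [Pi.smul_apply, smul_eq_mul, RingHom.id_apply]
    split_ifs <;> ring

/-- The cone operator with apex `v`: on basis elements, `σ ↦ ± (σ ∪ {v})` if `v ∉ σ` and `σ ↦ 0`
otherwise. -/
def coneVertex (K : Type*) [Field K] (v : V) : (Finset V → K) →ₗ[K] (Finset V → K) where
  toFun x τ := if v ∈ τ then (faceSign τ v : K) * x (τ.erase v) else 0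
  map_add' x y := by
    ext τ
    simp only [Pi.add_apply]
    split_ifs <;> ring
  map_smul' c x := by
    ext τ
    simp only [Pi.smul_apply, smul_eq_mul, RingHom.id_apply]
    split_ifs <;> ring

theorem contractVertex_apply (v : V) (x : Finset V → K) (τ : Finset V) :
    contractVertex K v x τ = if v ∈ τ then 0 else (faceSign τ v : K) * x (insert v τ) := rfl

theorem coneVertex_apply (v : V) (x : Finset V → K) (τ : Finset V) :
    coneVertex K v x τ = if v ∈ τ then (faceSign τ v : K) * x (τ.erase v) else 0 := rfl

theorem faceSign_mul_self (σ : Finset V) (v : V) :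
    (faceSign σ v : K) * (faceSign σ v : K) = 1 := by
  simp only [faceSign, Int.cast_pow, Int.cast_neg, Int.cast_one, ← mul_pow]
  simp

theorem faceSign_insert_self (σ : Finset V) (v : V) :
    faceSign (insert v σ) v = faceSign σ v := by
  simp [faceSign, Finset.filter_insert]

theorem faceSign_erase_self (σ : Finset V) (v : V) :
    faceSign (σ.erase v) v = faceSign σ v := by
  by_cases h : v ∈ σ
  · conv_rhs => rw [← Finset.insert_erase h, faceSign_insert_self]
  · rw [Finset.erase_eq_of_notMem h]

theorem faceSign_insert_of_lt {σ : Finset V} {u v : V} (hu : u ∉ σ) (h : u < v) :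
    faceSign (insert u σ) v = - faceSign σ v := by
  simp [faceSign, Finset.filter_insert, h, pow_succ, hu]

theorem faceSign_insert_of_gt {σ : Finset V} {u v : V} (h : v < u) :
    faceSign (insert u σ) v = faceSign σ v := by
  simp [faceSign, Finset.filter_insert, not_lt.2 h.le]

/-- Inserting `u` before `v` and `v` before `u` gives opposite signs. -/
theorem faceSign_insert_anticomm {σ : Finset V} {u v : V} (huv : u ≠ v) (hu : u ∉ σ) (hv : v ∉ σ) :
    (faceSign σ u : K) * faceSign (insert u σ) v
      = - ((faceSign σ v : K) * faceSign (insert v σ) u) := by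
  rcases lt_or_gt_of_ne huv with h | h
  · rw [faceSign_insert_of_lt hu h, faceSign_insert_of_gt h]
    push_cast
    ring
  · rw [faceSign_insert_of_lt hv h, faceSign_insert_of_gt h]
    push_cast
    ring

theorem contractVertex_anticomm (u v : V) (x : Finset V → K) :
    contractVertex K u (contractVertex K v x) = - contractVertex K v (contractVertex K u x) := by
  ext τ
  by_cases huv : u = v
  · subst huv
    simp [contractVertex_apply]
  by_cases hu : u ∈ τ
  · simp [contractVertex_apply, hu]
  by_cases hv : v ∈ τ
  · simp [contractVertex_apply, hv]
  simp only [contractVertex_apply, Pi.neg_apply, Finset.mem_insert, hu, hv, or_false, huv,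
    Ne.symm huv, if_false, Finset.insert_comm v u, ← mul_assoc]
  rw [faceSign_insert_anticomm huv hu hv]
  ring

theorem contractVertex_self (v : V) (x : Finset V → K) :
    contractVertex K v (contractVertex K v x) = 0 := by
  ext τ
  simp [contractVertex_apply]

theorem contractVertex_coneVertex_self (v : V) (x : Finset V → K) :
    contractVertex K v (coneVertex K v x) + coneVertex K v (contractVertex K v x) = x := by
  ext τ
  by_cases hv : v ∈ τ
  · simp [contractVertex_apply, coneVertex_apply, hv, faceSign_erase_self, ← mul_assoc,
      faceSign_mul_self]
  · simp [contractVertex_apply, coneVertex_apply, hv, faceSign_insert_self, ← mul_assoc,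
      faceSign_mul_self]

/-- Together with the case u = v, these are the anticommutation relations of annihilation and
creation operators. Summed over u, they make the cone operator a contracting homotopy for the
boundary. -/
theorem contractVertex_coneVertex {u v : V} (huv : u ≠ v) (x : Finset V → K) :
    contractVertex K u (coneVertex K v x) + coneVertex K v (contractVertex K u x) = 0 := by
  ext τ
  by_cases hu : u ∈ τ
  · simp [contractVertex_apply, coneVertex_apply, hu, huv]
  by_cases hv : v ∈ τ
  · obtain ⟨ρ, hρ, rfl⟩ : ∃ ρ, v ∉ ρ ∧ insert v ρ = τ :=
      ⟨τ.erase v, Finset.notMem_erase _ _, Finset.insert_erase hv⟩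
    have hu' : u ∉ ρ := fun h => hu (Finset.mem_insert_of_mem h)
    have e : (insert u (insert v ρ)).erase v = insert u ρ := by
      rw [Finset.insert_comm, Finset.erase_insert (by simp [hρ, Ne.symm huv])]
    simp only [contractVertex_apply, coneVertex_apply, Pi.add_apply, hu, hv, if_false, if_true,
      Finset.mem_insert, or_true, e, Finset.erase_insert hρ, hu', faceSign_insert_self,
      Pi.zero_apply]
    rw [Finset.insert_comm, faceSign_insert_self]
    have h4 : (faceSign (insert v ρ) u : K) * faceSign (insert u ρ) v
        = - ((faceSign ρ v : K) * faceSign ρ u) := by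
      rcases lt_or_gt_of_ne huv with h | h
      · rw [faceSign_insert_of_lt hu' h, faceSign_insert_of_gt h]
        push_cast
        ring
      · rw [faceSign_insert_of_lt hρ h, faceSign_insert_of_gt h]
        push_cast
        ring
    rw [← mul_assoc, h4]
    ring
  · simp [contractVertex_apply, coneVertex_apply, hv, Ne.symm huv]

variable {G : SimpleGraph V} {S S' L : Finset V} {v : V} {j : ℤ}

theorem contractVertex_mem_erase {x : Finset V → K} (hx : x ∈ indepChains K G S (j + 1)) :
    contractVertex K v x ∈ indepChains K G S j := by
  intro τ hτ
  rw [contractVertex_apply] at hτ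
  split_ifs at hτ with h
  · exact absurd rfl hτ
  obtain ⟨h1, h2, h3⟩ := hx _ (right_ne_zero_of_mul hτ)
  rw [Finset.card_insert_of_notMem h] at h3
  refine ⟨(Finset.subset_insert _ _).trans h1, h2.mono (by simp), ?_⟩
  push_cast at h3
  linarith

theorem contractVertex_mem (hL : ∀ w, w ∈ L ↔ w ∈ S ∧ w ≠ v ∧ ¬ G.Adj v w) {x : Finset V → K}
    (hx : x ∈ indepChains K G S (j + 1)) : contractVertex K v x ∈ indepChains K G L j := by
  intro τ hτ
  refine ⟨fun w hw => ?_, (contractVertex_mem_erase hx τ hτ).2⟩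
  rw [contractVertex_apply] at hτ
  split_ifs at hτ with h
  · exact absurd rfl hτ
  obtain ⟨h1, h2, -⟩ := hx _ (right_ne_zero_of_mul hτ)
  have hne : w ≠ v := fun e => h (e ▸ hw)
  exact (hL w).2 ⟨h1 (Finset.mem_insert_of_mem hw), hne,
    h2 (by simp) (by simp [hw]) hne.symm⟩

theorem coneVertex_mem (hv : v ∈ S) (hL : ∀ w, w ∈ L ↔ w ∈ S ∧ w ≠ v ∧ ¬ G.Adj v w)
    {x : Finset V → K} (hx : x ∈ indepChains K G L j) :
    coneVertex K v x ∈ indepChains K G S (j + 1) := by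
  intro τ hτ
  rw [coneVertex_apply] at hτ
  split_ifs at hτ with h
  swap
  · exact absurd rfl hτ
  obtain ⟨h1, h2, h3⟩ := hx _ (right_ne_zero_of_mul hτ)
  rw [← Finset.insert_erase h]
  refine ⟨?_, ?_, ?_⟩
  · exact Finset.insert_subset hv fun w hw => ((hL w).1 (h1 hw)).1
  · rw [SimpleGraph.IsIndepSet, Finset.coe_insert, Set.pairwise_insert]
    refine ⟨h2, fun w hw _ => ?_⟩
    have := ((hL w).1 (h1 hw)).2.2
    exact ⟨this, fun h' => this h'.symm⟩
  · rw [Finset.card_insert_of_notMem (Finset.notMem_erase _ _)]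
    push_cast
    linarith

theorem contractVertex_eq_zero {x : Finset V → K} (hx : x ∈ indepChains K G S j) (hv : v ∉ S) :
    contractVertex K v x = 0 := by
  ext τ
  rw [contractVertex_apply]
  split_ifs with h
  · rfl
  · by_contra h0
    exact hv ((hx _ (right_ne_zero_of_mul h0)).1 (Finset.mem_insert_self _ _))

theorem mem_indepChains_erase {x : Finset V → K} (hx : x ∈ indepChains K G S j)
    (h : contractVertex K v x = 0) : x ∈ indepChains K G (S.erase v) j := by
  intro τ hτ
  obtain ⟨h1, h2⟩ := hx τ hτ
  refine ⟨fun w hw => Finset.mem_erase.2 ⟨?_, h1 hw⟩, h2⟩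
  rintro rfl
  have := congrFun h (τ.erase w)
  simp only [contractVertex_apply, Finset.notMem_erase, if_false, Finset.insert_erase hw,
    Pi.zero_apply] at this
  rcases mul_eq_zero.1 this with h0 | h0
  · have h4 := faceSign_mul_self (K := K) (τ.erase w) w
    simp [h0] at h4
  · exact hτ h0

theorem subset_erase_of_link (hL : ∀ w, w ∈ L ↔ w ∈ S ∧ w ≠ v ∧ ¬ G.Adj v w) : L ⊆ S.erase v :=
  fun w hw => Finset.mem_erase.2 ⟨((hL w).1 hw).2.1, ((hL w).1 hw).1⟩

theorem contractVertex_coneVertex_of_link (hL : ∀ w, w ∈ L ↔ w ∈ S ∧ w ≠ v ∧ ¬ G.Adj v w)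
    {x : Finset V → K} (hx : x ∈ indepChains K G L j) :
    contractVertex K v (coneVertex K v x) = x := by
  have h := contractVertex_coneVertex_self v x
  rwa [contractVertex_eq_zero hx (notMem_of_link hL), map_zero, add_zero] at h

/-! ### Cycles, boundaries and the deletion–link exact sequence -/

variable [Fintype V]

/-- The boundary operator of the full simplex on the vertex set `V`, on chains of all degrees. -/
def simplexBoundary (K : Type*) [Field K] (V : Type*) [LinearOrder V] [Fintype V] :
    (Finset V → K) →ₗ[K] (Finset V → K) :=
  ∑ v, contractVertex K v

theorem simplexBoundary_apply (x : Finset V → K) :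
    simplexBoundary K V x = ∑ v, contractVertex K v x := by
  simp [simplexBoundary]

theorem simplexBoundary_contractVertex (v : V) (x : Finset V → K) :
    simplexBoundary K V (contractVertex K v x) = - contractVertex K v (simplexBoundary K V x) := by
  simp only [simplexBoundary_apply, map_sum, ← Finset.sum_neg_distrib]
  exact Finset.sum_congr rfl fun u _ => contractVertex_anticomm u v x

theorem simplexBoundary_coneVertex (v : V) (x : Finset V → K) :
    simplexBoundary K V (coneVertex K v x) = x - coneVertex K v (simplexBoundary K V x) := by
  rw [eq_sub_iff_add_eq]
  simp only [simplexBoundary_apply, map_sum, ← Finset.sum_add_distrib]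
  rw [Finset.sum_eq_single v]
  · exact contractVertex_coneVertex_self v x
  · exact fun u _ hu => contractVertex_coneVertex hu x
  · simp

theorem simplexBoundary_simplexBoundary (x : Finset V → K) :
    simplexBoundary K V (simplexBoundary K V x) = 0 := by
  simp only [simplexBoundary_apply, map_sum]
  rw [← Finset.univ.sum_product' Finset.univ
    fun u v => contractVertex K v (contractVertex K u x)]
  refine Finset.sum_involution (fun p _ => (p.2, p.1)) ?_ ?_ ?_ ?_
  · rintro ⟨u, v⟩ _
    simp [contractVertex_anticomm u v]
  · rintro ⟨u, v⟩ _ h e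
    have : v = u := congrArg Prod.fst e
    subst this
    exact h (contractVertex_self _ _)
  · simp
  · simp

theorem simplexBoundary_mem {x : Finset V → K} (hx : x ∈ indepChains K G S (j + 1)) :
    simplexBoundary K V x ∈ indepChains K G S j := by
  rw [simplexBoundary_apply]
  exact Submodule.sum_mem _ fun v _ => contractVertex_mem_erase hx

/-- The cycles of dimension `j` of the independence complex of the induced subgraph. -/
def indepCycles (K : Type*) [Field K] (G : SimpleGraph V) (S : Finset V) (j : ℤ) :
    Submodule K (Finset V → K) :=
  indepChains K G S j ⊓ LinearMap.ker (simplexBoundary K V)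

/-- The boundaries of dimension `j` of the independence complex of the induced subgraph. -/
def indepBoundaries (K : Type*) [Field K] (G : SimpleGraph V) (S : Finset V) (j : ℤ) :
    Submodule K (Finset V → K) :=
  (indepChains K G S (j + 1)).map (simplexBoundary K V)

theorem mem_indepCycles {x : Finset V → K} :
    x ∈ indepCycles K G S j ↔ x ∈ indepChains K G S j ∧ simplexBoundary K V x = 0 := Iff.rfl

theorem indepBoundaries_le_indepCycles : indepBoundaries K G S j ≤ indepCycles K G S j := by
  rintro _ ⟨y, hy, rfl⟩
  exact ⟨simplexBoundary_mem hy, simplexBoundary_simplexBoundary y⟩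

theorem indepCycles_mono (h : S ⊆ S') : indepCycles K G S j ≤ indepCycles K G S' j :=
  inf_le_inf_right _ (indepChains_mono h)

theorem indepBoundaries_mono (h : S ⊆ S') : indepBoundaries K G S j ≤ indepBoundaries K G S' j :=
  Submodule.map_mono (indepChains_mono h)

/-- The connecting map from the homology of the link to that of the deletion vanishes here: a cycle
b of the link bounds some a avoiding v, and the cone over b minus a is a cycle that contracts to b.
-/
theorem indepCycles_map_contractVertex (hv : v ∈ S)
    (hL : ∀ w, w ∈ L ↔ w ∈ S ∧ w ≠ v ∧ ¬ G.Adj v w)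
    (h : indepCycles K G (S.erase v) j ≤ indepBoundaries K G (S.erase v) j) :
    (indepCycles K G S (j + 1)).map (contractVertex K v) = indepCycles K G L j := by
  ext b
  constructor
  · rintro ⟨x, hx, rfl⟩
    refine ⟨contractVertex_mem hL hx.1, ?_⟩
    rw [SetLike.mem_coe, LinearMap.mem_ker,
      simplexBoundary_contractVertex, (mem_indepCycles.1 hx).2, map_zero,
      neg_zero]
  · intro hb
    obtain ⟨a, ha, rfl⟩ := h (indepCycles_mono (subset_erase_of_link hL) hb)
    refine ⟨coneVertex K v (simplexBoundary K V a) - a, ⟨?_, ?_⟩, ?_⟩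
    · exact Submodule.sub_mem _ (coneVertex_mem hv hL hb.1)
        (indepChains_mono (Finset.erase_subset v S) ha)
    · rw [SetLike.mem_coe, LinearMap.mem_ker,
        map_sub, simplexBoundary_coneVertex, simplexBoundary_simplexBoundary,
        map_zero, sub_zero, sub_self]
    · rw [map_sub, contractVertex_coneVertex_of_link hL hb.1,
        contractVertex_eq_zero ha (Finset.notMem_erase _ _), sub_zero]

theorem indepCycles_inf_ker_contractVertex :
    indepCycles K G S j ⊓ LinearMap.ker (contractVertex K v) = indepCycles K G (S.erase v) j := by
  ext x
  constructor
  · rintro ⟨⟨h1, h2⟩, h3⟩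
    exact ⟨mem_indepChains_erase h1 h3, h2⟩
  · intro h
    exact ⟨indepCycles_mono (Finset.erase_subset v S) h,
      contractVertex_eq_zero h.1 (Finset.notMem_erase _ _)⟩

/-- Contraction anticommutes with the boundary, and the cone operator is a section of it on chains
of the link. -/
theorem indepBoundaries_map_contractVertex (hv : v ∈ S)
    (hL : ∀ w, w ∈ L ↔ w ∈ S ∧ w ≠ v ∧ ¬ G.Adj v w) :
    (indepBoundaries K G S (j + 1)).map (contractVertex K v) = indepBoundaries K G L j := by
  ext b
  constructor
  · rintro ⟨_, ⟨y, hy, rfl⟩, rfl⟩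
    refine ⟨- contractVertex K v y, Submodule.neg_mem _ (contractVertex_mem hL hy), ?_⟩
    rw [map_neg, simplexBoundary_contractVertex, neg_neg]
  · rintro ⟨b, hb, rfl⟩
    refine ⟨_, ⟨- coneVertex K v b, Submodule.neg_mem _ (coneVertex_mem hv hL hb), rfl⟩, ?_⟩
    rw [← neg_inj, ← simplexBoundary_contractVertex, map_neg,
      contractVertex_coneVertex_of_link hL hb, map_neg]

/-- If ∂y avoids v, the contraction of y is a cycle of the link, hence ∂b for some b there. Adding
the boundary of the cone over b to y removes v without changing ∂y. -/
theorem indepBoundaries_inf_ker_contractVertex (hv : v ∈ S)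
    (hL : ∀ w, w ∈ L ↔ w ∈ S ∧ w ≠ v ∧ ¬ G.Adj v w)
    (h : indepCycles K G L j ≤ indepBoundaries K G L j) :
    indepBoundaries K G S j ⊓ LinearMap.ker (contractVertex K v)
      = indepBoundaries K G (S.erase v) j := by
  ext x
  constructor
  · rintro ⟨⟨y, hy, rfl⟩, h3⟩
    have hpy : contractVertex K v y ∈ indepCycles K G L j := by
      refine ⟨contractVertex_mem hL hy, ?_⟩
      rw [SetLike.mem_coe, LinearMap.mem_ker,
        simplexBoundary_contractVertex, LinearMap.mem_ker.1 h3, neg_zero]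
    obtain ⟨b, hb, hby⟩ := h hpy
    have hw := simplexBoundary_coneVertex v b
    refine ⟨y + simplexBoundary K V (coneVertex K v b), mem_indepChains_erase
      (Submodule.add_mem _ hy (simplexBoundary_mem (coneVertex_mem hv hL hb))) ?_, ?_⟩
    · rw [hw, hby, map_add, map_sub, contractVertex_coneVertex_of_link hL hpy.1,
        contractVertex_eq_zero hb (notMem_of_link hL)]
      abel
    · rw [map_add, simplexBoundary_simplexBoundary, add_zero]
  · intro hx
    exact ⟨indepBoundaries_mono (Finset.erase_subset v S) hx, contractVertex_eq_zero
      (indepBoundaries_le_indepCycles hx).1 (Finset.notMem_erase _ _)⟩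

theorem finrank_map_add_finrank_inf_ker {M N : Type*} [AddCommGroup M] [Module K M]
    [AddCommGroup N] [Module K N] [FiniteDimensional K M] (f : M →ₗ[K] N) (P : Submodule K M) :
    Module.finrank K (P.map f) + Module.finrank K (P ⊓ LinearMap.ker f : Submodule K M)
      = Module.finrank K P := by
  rw [← LinearMap.finrank_range_add_finrank_ker (f.domRestrict P), LinearMap.range_domRestrict,
    LinearMap.ker_domRestrict, ← Submodule.finrank_map_subtype_eq, Submodule.map_comap_subtype]

/-- The reduced homology of the independence complex of the subgraph induced by `S` has dimension
`r` in degree `d` and vanishes in all other degrees. -/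
def HomologyConcentrated (K : Type*) [Field K] (G : SimpleGraph V) (S : Finset V) (d : ℤ) (r : ℕ) :
    Prop :=
  (∀ j, j ≠ d → indepCycles K G S j ≤ indepBoundaries K G S j) ∧
    Module.finrank K (indepCycles K G S d) = Module.finrank K (indepBoundaries K G S d) + r

theorem homologyConcentrated_empty : HomologyConcentrated K G ∅ (-1) 1 := by
  have hB : indepBoundaries K G ∅ (-1) = ⊥ := by
    rw [eq_bot_iff]
    rintro _ ⟨y, hy, rfl⟩
    have : y = 0 := by
      ext τ
      by_contra h
      obtain ⟨h1, -, h2⟩ := hy τ h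
      rw [Finset.subset_empty.1 h1] at h2
      simp at h2
    simp [this]
  have hZ : indepCycles K G ∅ (-1) = Submodule.span K {(Pi.single ∅ 1 : Finset V → K)} := by
    ext x
    rw [Submodule.mem_span_singleton]
    constructor
    · intro hx
      refine ⟨x ∅, ?_⟩
      ext τ
      by_cases hτ : τ = ∅
      · subst hτ; simp
      · simp only [Pi.smul_apply, Pi.single_apply, hτ, if_false, smul_zero]
        by_contra h
        exact hτ (Finset.subset_empty.1 (hx.1 τ (Ne.symm h)).1)
    · rintro ⟨c, rfl⟩
      refine ⟨fun τ h => ?_, ?_⟩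
      · by_cases hτ : τ = ∅
        · subst hτ; simp [SimpleGraph.IsIndepSet]
        · simp [hτ] at h
      · rw [SetLike.mem_coe, LinearMap.mem_ker,
          simplexBoundary_apply]
        refine Finset.sum_eq_zero fun v _ => ?_
        ext τ
        simp [contractVertex_apply]
  refine ⟨fun j hj x hx => ?_, ?_⟩
  · have : x = 0 := by
      ext τ
      by_contra h
      obtain ⟨h1, -, h2⟩ := hx.1 τ h
      rw [Finset.subset_empty.1 h1] at h2
      apply hj
      simp at h2
      linarith
    rw [this]
    exact Submodule.zero_mem _
  · rw [hB, hZ, finrank_bot, finrank_span_singleton]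
    intro h
    simpa using congrFun h ∅

/-- An isolated vertex is a cone apex, so all reduced homology vanishes; with rank 0 the degree d is
arbitrary. -/
theorem homologyConcentrated_cone {u : V} (hu : u ∈ S) (h : ∀ w ∈ S, ¬ G.Adj u w) (d : ℤ) :
    HomologyConcentrated K G S d 0 := by
  have key : ∀ j, indepCycles K G S j = indepBoundaries K G S j := by
    intro j
    refine le_antisymm (fun x hx => ⟨coneVertex K u x, ?_, ?_⟩) indepBoundaries_le_indepCycles
    · intro τ hτ
      rw [coneVertex_apply] at hτ
      split_ifs at hτ with h'
      swap
      · exact absurd rfl hτ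
      obtain ⟨h1, h2, h3⟩ := hx.1 _ (right_ne_zero_of_mul hτ)
      rw [← Finset.insert_erase h']
      refine ⟨Finset.insert_subset hu h1, ?_, ?_⟩
      · rw [SimpleGraph.IsIndepSet, Finset.coe_insert, Set.pairwise_insert]
        refine ⟨h2, fun w hw _ => ?_⟩
        have := h w (h1 hw)
        exact ⟨this, fun h' => this h'.symm⟩
      · rw [Finset.card_insert_of_notMem (Finset.notMem_erase _ _)]
        push_cast
        linarith
    · rw [simplexBoundary_coneVertex, (mem_indepCycles.1 hx).2, map_zero, sub_zero]
  exact ⟨fun j _ => (key j).le, by rw [key d, add_zero]⟩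

/-- Rank–nullity for contraction by v, applied to cycles and to boundaries in degree d + 1: the
images belong to the link in degree d, the kernels to the deletion in degree d + 1. Since the two
pieces are concentrated in these degrees, no connecting map interferes. -/
theorem homologyConcentrated_split {d : ℤ} {r s : ℕ} (hv : v ∈ S)
    (hL : ∀ w, w ∈ L ↔ w ∈ S ∧ w ≠ v ∧ ¬ G.Adj v w)
    (h1 : HomologyConcentrated K G (S.erase v) (d + 1) r) (h2 : HomologyConcentrated K G L d s) :
    HomologyConcentrated K G S (d + 1) (r + s) := by
  constructor
  · intro j hj x hx
    obtain ⟨j, rfl⟩ : ∃ i, j = i + 1 := ⟨j - 1, by ring⟩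
    have hpx : contractVertex K v x ∈ indepCycles K G L j := by
      refine ⟨contractVertex_mem hL hx.1, ?_⟩
      rw [SetLike.mem_coe, LinearMap.mem_ker,
        simplexBoundary_contractVertex, (mem_indepCycles.1 hx).2, map_zero,
        neg_zero]
    obtain ⟨b, hb, hbx⟩ := h2.1 j (by rintro rfl; exact hj rfl) hpx
    have hcb := coneVertex_mem hv hL hb
    have hz : x + simplexBoundary K V (coneVertex K v b) ∈ indepCycles K G (S.erase v) (j + 1) := by
      rw [← indepCycles_inf_ker_contractVertex]
      refine ⟨Submodule.add_mem _ hx (indepBoundaries_le_indepCycles ⟨_, hcb, rfl⟩), ?_⟩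
      rw [SetLike.mem_coe, LinearMap.mem_ker,
        simplexBoundary_coneVertex, hbx, map_add, map_sub,
        contractVertex_coneVertex_of_link hL hpx.1, contractVertex_eq_zero hb (notMem_of_link hL)]
      abel
    have := Submodule.sub_mem _
      (indepBoundaries_mono (Finset.erase_subset v S) (h1.1 _ hj hz)) ⟨_, hcb, rfl⟩
    rwa [add_sub_cancel_right] at this
  · rw [← finrank_map_add_finrank_inf_ker (contractVertex K v) (indepCycles K G S (d + 1)),
      ← finrank_map_add_finrank_inf_ker (contractVertex K v) (indepBoundaries K G S (d + 1)),
      indepCycles_map_contractVertex hv hL (h1.1 d (by simp)), indepCycles_inf_ker_contractVertex,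
      indepBoundaries_map_contractVertex hv hL,
      indepBoundaries_inf_ker_contractVertex hv hL (h2.1 (d + 1) (by simp)), h1.2, h2.2]
    ring

end SimplicialChains

/-! ### Comparison with the homology of the reduced chain complex -/

section ReducedHomologyDimension

variable {K : Type*} [Field K] {V : Type*} [LinearOrder V]

/-- The inclusion of the chains spanned by the faces of dimension `j` into all chains. -/
noncomputable def chainInclusion (K : Type*) [Field K] (Δ : PreAbstractSimplicialComplex V) (j : ℤ) :
    (FaceOfDim Δ j →₀ K) →ₗ[K] (Finset V → K) :=
  Finsupp.linearCombination K fun σ => Pi.single σ.1 1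

theorem chainInclusion_injective (Δ : PreAbstractSimplicialComplex V) (j : ℤ) :
    Function.Injective (chainInclusion K Δ j) :=
  (Pi.linearIndependent_single_one (Finset V) K).comp _ Subtype.val_injective

theorem contractVertex_single (σ : Finset V) (v : V) :
    contractVertex K v (Pi.single σ 1) =
      if v ∈ σ then Pi.single (σ.erase v) (faceSign σ v : K) else 0 := by
  ext τ
  rw [contractVertex_apply]
  split_ifs with h1 h2 h2
  · rw [Pi.single_eq_of_ne]
    rintro rfl
    simp at h1
  · rfl
  · by_cases h : τ = σ.erase v
    · subst h
      simp [Finset.insert_erase h2, faceSign_erase_self]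
    · have : insert v τ ≠ σ := by
        rintro rfl
        exact h (Finset.erase_insert h1).symm
      simp [this, h]
  · have : insert v τ ≠ σ := by
      rintro rfl
      simp at h2
    simp [this]

variable [Fintype V]

theorem range_chainInclusion (G : SimpleGraph V) (j : ℤ) :
    LinearMap.range (chainInclusion K (independenceComplex G).toPreAbstractSimplicialComplex j)
      = indepChains K G Finset.univ j := by
  apply le_antisymm
  · rw [chainInclusion, Finsupp.range_linearCombination, Submodule.span_le]
    rintro _ ⟨σ, rfl⟩ τ hτ
    obtain rfl : τ = σ.1 := by
      by_contra h
      simp [h] at hτ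
    refine ⟨Finset.subset_univ _, ?_, σ.2.2⟩
    rcases σ.2.1 with h | h
    · simp [h, SimpleGraph.IsIndepSet]
    · exact h.2
  · intro x hx
    have : x = ∑ τ, x τ • (Pi.single τ 1 : Finset V → K) := by
      ext τ
      simp [Finset.sum_apply, Pi.single_apply]
    rw [this]
    refine Submodule.sum_mem _ fun τ _ => ?_
    by_cases h0 : x τ = 0
    · simp [h0]
    obtain ⟨-, h1, h2⟩ := hx τ h0
    refine Submodule.smul_mem _ _ ⟨Finsupp.single ⟨τ, ?_, h2⟩ 1, by simp [chainInclusion]⟩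
    rcases τ.eq_empty_or_nonempty with h | h
    · exact Or.inl h
    · exact Or.inr ⟨h, h1⟩

theorem chainInclusion_reducedBoundary (Δ : PreAbstractSimplicialComplex V) (j : ℤ)
    (x : FaceOfDim Δ (j + 1) →₀ K) :
    chainInclusion K Δ j (reducedBoundary K Δ (j + 1) j x)
      = simplexBoundary K V (chainInclusion K Δ (j + 1) x) := by
  suffices h : chainInclusion K Δ j ∘ₗ reducedBoundary K Δ (j + 1) j
      = simplexBoundary K V ∘ₗ chainInclusion K Δ (j + 1) from LinearMap.congr_fun h x
  apply Finsupp.lhom_ext'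
  intro σ
  ext1
  simp only [LinearMap.comp_apply, Finsupp.lsingle_apply, reducedBoundary, chainInclusion,
    Finsupp.linearCombination_single, one_smul, map_sum, simplexBoundary_apply,
    contractVertex_single]
  rw [Finset.sum_ite_mem, Finset.univ_inter]
  refine Finset.sum_congr rfl fun v hv => ?_
  have h1 := Finset.card_erase_add_one hv
  have h2 := σ.2.2
  rw [dif_pos (by omega), Finsupp.linearCombination_single, ← Pi.single_smul, smul_eq_mul, mul_one]

theorem map_ker_reducedBoundary (G : SimpleGraph V) (j : ℤ) :
    (LinearMap.ker (reducedBoundary K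
      (independenceComplex G).toPreAbstractSimplicialComplex (j + 1) j)).map
      (chainInclusion K (independenceComplex G).toPreAbstractSimplicialComplex (j + 1))
      = indepCycles K G Finset.univ (j + 1) := by
  ext x
  rw [mem_indepCycles, ← range_chainInclusion]
  constructor
  · rintro ⟨y, hy, rfl⟩
    refine ⟨⟨y, rfl⟩, ?_⟩
    rw [← chainInclusion_reducedBoundary, LinearMap.mem_ker.1 hy, map_zero]
  · rintro ⟨⟨y, rfl⟩, h⟩
    refine ⟨y, chainInclusion_injective _ j ?_, rfl⟩
    rw [chainInclusion_reducedBoundary, h, map_zero]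

theorem map_range_reducedBoundary (G : SimpleGraph V) (j : ℤ) :
    (LinearMap.range (reducedBoundary K
      (independenceComplex G).toPreAbstractSimplicialComplex (j + 1) j)).map
      (chainInclusion K (independenceComplex G).toPreAbstractSimplicialComplex j)
      = indepBoundaries K G Finset.univ j := by
  rw [indepBoundaries, ← range_chainInclusion, ← LinearMap.range_comp, ← LinearMap.range_comp]
  congr 1
  exact LinearMap.ext fun x => chainInclusion_reducedBoundary _ j x

open CategoryTheory in
theorem finrank_moduleCat_homology {R : Type*} [Field R] (S : ShortComplex (ModuleCat R))
    [FiniteDimensional R S.X₂] :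
    FiniteDimensional R S.homology ∧
      Module.finrank R S.homology + Module.finrank R (LinearMap.range S.f.hom)
        = Module.finrank R (LinearMap.ker S.g.hom) := by
  have e : S.homology ≃ₗ[R] (LinearMap.ker S.g.hom ⧸ LinearMap.range S.moduleCatToCycles) :=
    S.moduleCatHomologyIso.toLinearEquiv
  refine ⟨e.symm.finiteDimensional, ?_⟩
  have h : Module.finrank R (LinearMap.range S.f.hom)
      = Module.finrank R (LinearMap.range S.moduleCatToCycles) := by
    rw [← Submodule.finrank_map_subtype_eq _ (LinearMap.range S.moduleCatToCycles),
      ← LinearMap.range_comp]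
    rfl
  rw [e.finrank_eq, h, Submodule.finrank_quotient_add_finrank]

theorem finrank_reducedHomology (G : SimpleGraph V) (j : ℤ) :
    FiniteDimensional K
      (reducedHomology K (independenceComplex G).toPreAbstractSimplicialComplex j) ∧
    Module.finrank K (reducedHomology K (independenceComplex G).toPreAbstractSimplicialComplex j)
      + Module.finrank K (indepBoundaries K G Finset.univ j)
      = Module.finrank K (indepCycles K G Finset.univ j) := by
  obtain ⟨j, rfl⟩ : ∃ i, j = i + 1 := ⟨j - 1, by ring⟩
  set Δ := (independenceComplex G).toPreAbstractSimplicialComplex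
  have e := ((reducedChainComplex K Δ).homologyIsoSc' (j + 1 + 1) (j + 1) j (by simp)
    (by simp)).toLinearEquiv
  have : FiniteDimensional K ((reducedChainComplex K Δ).sc' (j + 1 + 1) (j + 1) j).X₂ :=
    inferInstanceAs (FiniteDimensional K (FaceOfDim Δ (j + 1) →₀ K))
  obtain ⟨h1, h2⟩ := finrank_moduleCat_homology
    ((reducedChainComplex K Δ).sc' (j + 1 + 1) (j + 1) j)
  refine ⟨e.symm.finiteDimensional, ?_⟩
  rw [← map_range_reducedBoundary, ← map_ker_reducedBoundary,
    ← (Submodule.equivMapOfInjective _ (chainInclusion_injective Δ (j + 1)) _).finrank_eq,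
    ← (Submodule.equivMapOfInjective _ (chainInclusion_injective Δ (j + 1)) _).finrank_eq]
  refine Eq.trans ?_ h2
  congr 1
  exact e.finrank_eq

theorem HomologyConcentrated.reducedHomology {G : SimpleGraph V} {d : ℤ} {r : ℕ}
    (h : HomologyConcentrated K G Finset.univ d r) :
    Nonempty (reducedHomology K (independenceComplex G).toPreAbstractSimplicialComplex d
      ≃ₗ[K] (Fin r → K)) ∧
    ∀ j, j ≠ d →
      Subsingleton (_root_.reducedHomology K
        (independenceComplex G).toPreAbstractSimplicialComplex j) := by
  constructor
  · obtain ⟨h1, h2⟩ := finrank_reducedHomology (K := K) G d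
    have := h.2
    exact FiniteDimensional.nonempty_linearEquiv_of_finrank_eq (by
      rw [Module.finrank_fin_fun]
      omega)
  · intro j hj
    obtain ⟨h1, h2⟩ := finrank_reducedHomology (K := K) G j
    have := Submodule.finrank_mono (h.1 j hj)
    exact (Module.finrank_zero_iff (R := K)).1 (by omega)

end ReducedHomologyDimension

/-! ### Combinatorial certificates for the homology -/

section Splitting

/-- `SphericalSplitting G S d r` says that the reduced homology of the independence complex of the
subgraph of `G` induced by `S` can be computed, with the result that it has dimension `r` in degree
`d` and vanishes in the other degrees, by repeatedly splitting off a vertex `v`, i.e. by passing to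
`S \ {v}` and to `S \ N[v]`, until the subgraph is empty or has an isolated vertex. -/
inductive SphericalSplitting {V : Type*} (G : SimpleGraph V) : Finset V → ℤ → ℕ → Prop
  | empty : SphericalSplitting G ∅ (-1) 1
  | cone {S : Finset V} {u : V} (d : ℤ) (hu : u ∈ S) (h : ∀ w ∈ S, ¬ G.Adj u w) :
      SphericalSplitting G S d 0
  | split {S S' L : Finset V} {v : V} {d : ℤ} {r s : ℕ} (hv : v ∈ S)
      (hS' : ∀ w, w ∈ S' ↔ w ∈ S ∧ w ≠ v) (hL : ∀ w, w ∈ L ↔ w ∈ S ∧ w ≠ v ∧ ¬ G.Adj v w)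
      (h1 : SphericalSplitting G S' (d + 1) r) (h2 : SphericalSplitting G L d s) :
      SphericalSplitting G S (d + 1) (r + s)

theorem SphericalSplitting.homologyConcentrated (K : Type*) [Field K] {V : Type*} [LinearOrder V]
    [Fintype V] {G : SimpleGraph V} {S : Finset V} {d : ℤ} {r : ℕ}
    (h : SphericalSplitting G S d r) : HomologyConcentrated K G S d r := by
  induction h with
  | empty => exact homologyConcentrated_empty
  | cone d hu h => exact homologyConcentrated_cone hu h d
  | @split S S' L v d r s hv hS' hL _ _ h1 h2 =>
    obtain rfl : S' = S.erase v := by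
      ext w
      rw [hS', Finset.mem_erase, and_comm]
    exact homologyConcentrated_split hv hL h1 h2

/-- Only adjacency matters to a certificate, so it passes to an isomorphic induced subgraph even
when the ambient vertex type changes from infinite to finite. -/
theorem SphericalSplitting.image {V W : Type*} [DecidableEq W] {G : SimpleGraph V}
    {H : SimpleGraph W} {S : Finset V} {d : ℤ} {r : ℕ} (h : SphericalSplitting G S d r) (f : V → W)
    (hf : Set.InjOn f S) (hadj : ∀ a ∈ S, ∀ b ∈ S, H.Adj (f a) (f b) ↔ G.Adj a b) :
    SphericalSplitting H (S.image f) d r := by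
  induction h with
  | empty => exact .empty
  | cone d hu h =>
    refine .cone d (Finset.mem_image_of_mem f hu) fun w hw => ?_
    obtain ⟨b, hb, rfl⟩ := Finset.mem_image.1 hw
    rw [hadj _ hu _ hb]
    exact h b hb
  | @split S S' L v d r s hv hS' hL _ _ h1 h2 =>
    have hS : ∀ w ∈ S', w ∈ S := fun w hw => ((hS' w).1 hw).1
    have hLS : ∀ w ∈ L, w ∈ S := fun w hw => ((hL w).1 hw).1
    refine .split (Finset.mem_image_of_mem f hv) (fun w => ?_) (fun w => ?_)
      (h1 (hf.mono hS) fun a ha b hb => hadj a (hS a ha) b (hS b hb))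
      (h2 (hf.mono hLS) fun a ha b hb => hadj a (hLS a ha) b (hLS b hb))
    · simp only [Finset.mem_image]
      constructor
      · rintro ⟨b, hb, rfl⟩
        obtain ⟨h3, h4⟩ := (hS' b).1 hb
        exact ⟨⟨b, h3, rfl⟩, fun e => h4 (hf h3 hv e)⟩
      · rintro ⟨⟨b, hb, rfl⟩, h3⟩
        exact ⟨b, (hS' b).2 ⟨hb, fun e => h3 (e ▸ rfl)⟩, rfl⟩
    · simp only [Finset.mem_image]
      constructor
      · rintro ⟨b, hb, rfl⟩
        obtain ⟨h3, h4, h5⟩ := (hL b).1 hb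
        exact ⟨⟨b, h3, rfl⟩, fun e => h4 (hf h3 hv e), fun e => h5 ((hadj v hv b h3).1 e)⟩
      · rintro ⟨⟨b, hb, rfl⟩, h3, h4⟩
        exact ⟨b, (hL b).2 ⟨hb, fun e => h3 (e ▸ rfl), fun e => h4 ((hadj v hv b hb).2 e)⟩, rfl⟩

/-- If `N(u) ⊆ N(v)` for distinct vertices `u, v`, then `v` can be deleted. -/
theorem SphericalSplitting.fold {V : Type*} {G : SimpleGraph V} {S S' : Finset V} {u v : V} {d : ℤ}
    {r : ℕ} (hv : v ∈ S) (hS' : ∀ w, w ∈ S' ↔ w ∈ S ∧ w ≠ v) (hu : u ∈ S) (huv : u ≠ v)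
    (hadj : ¬ G.Adj v u) (h : ∀ w ∈ S, G.Adj u w → G.Adj v w) (h1 : SphericalSplitting G S' d r) :
    SphericalSplitting G S d r := by
  classical
  -- Split at v with link rank 0: in the link, u has lost all its neighbours, since they are
  -- neighbours of v.
  rw [← sub_add_cancel d 1, ← add_zero r]
  rw [← sub_add_cancel d 1] at h1
  refine .split (L := S.filter fun w => w ≠ v ∧ ¬ G.Adj v w) hv hS' (fun w => by simp) h1
    (.cone (u := u) _ (by simp [hu, huv, hadj]) fun w hw h2 => ?_)
  obtain ⟨h3, -, h4⟩ := Finset.mem_filter.1 hw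
  exact h4 (h w h3 h2)

end Splitting

/-! ### Finite sets of integers and their runs -/

section LinearModel

/-- The graph on the integers in which `a < b` are adjacent if and only if `b - a ≡ 1 (mod t)` and
`b - a ≠ 1`. -/
def stepGraph (t : ℤ) : SimpleGraph ℤ where
  Adj a b := (2 ≤ b - a ∧ t ∣ b - a - 1) ∨ (2 ≤ a - b ∧ t ∣ a - b - 1)
  symm := ⟨fun _ _ h => h.symm⟩
  loopless := ⟨fun a h => by simp at h⟩

theorem stepGraph_adj {t a b : ℤ} : (stepGraph t).Adj a b ↔
    (2 ≤ b - a ∧ t ∣ b - a - 1) ∨ (2 ≤ a - b ∧ t ∣ a - b - 1) := Iff.rfl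

theorem stepGraph_not_adj {t a b : ℤ} (h1 : b - a ≤ t) (h2 : a - b ≤ t) :
    ¬ (stepGraph t).Adj a b := by
  rintro (⟨h3, h4⟩ | ⟨h3, h4⟩)
  · have := Int.le_of_dvd (by omega) h4
    omega
  · have := Int.le_of_dvd (by omega) h4
    omega

open Classical in
/-- The first elements of those maximal runs of consecutive elements of `A` whose length is at
least `t`. -/
noncomputable def runStarts (t : ℤ) (A : Finset ℤ) : Finset ℤ :=
  A.filter fun x => x - 1 ∉ A ∧ ∀ y, x ≤ y → y < x + t → y ∈ A

theorem mem_runStarts {t : ℤ} {A : Finset ℤ} {x : ℤ} : x ∈ runStarts t A ↔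
    x ∈ A ∧ x - 1 ∉ A ∧ ∀ y, x ≤ y → y < x + t → y ∈ A := by
  classical
  rw [runStarts, Finset.mem_filter]

variable {t a c e : ℤ} {A : Finset ℤ}

/-- The last element `c` of a run of `A` can be deleted if some `c - s * t` lies in `A` and, for
`1 ≤ j < s`, none of the `c + 1 - j * t` does. -/
theorem SphericalSplitting.erase_runEnd (ht : 1 ≤ t) {s : ℤ} (hc : c ∈ A) (hc1 : c + 1 ∉ A)
    (hs : 1 ≤ s) (hcs : c - s * t ∈ A) (hj : ∀ j, 1 ≤ j → j < s → c + 1 - j * t ∉ A) {d : ℤ} {r : ℕ}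
    (h : SphericalSplitting (stepGraph t) (A.erase c) d r) :
    SphericalSplitting (stepGraph t) A d r := by
  have hst : t ≤ s * t := by nlinarith
  refine .fold (u := c - s * t) hc (fun w => by rw [Finset.mem_erase, and_comm]) hcs (by omega)
    ?_ ?_ h
  -- Adjacency would give t ∣ 1, so t = 1 and s ≥ 2; then `hj` with j = 1 contradicts c ∈ A.
  · rintro (⟨h1, h2⟩ | ⟨h1, h2⟩)
    · omega
    · have h3 : t ∣ 1 := by
        have h4 : t ∣ s * t := Dvd.intro_left s rfl
        have := Int.dvd_sub h4 h2
        ring_nf at this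
        exact this
      have h5 := Int.le_of_dvd (by omega) h3
      obtain rfl : t = 1 := by omega
      refine hj 1 le_rfl (by omega) ?_
      simpa using hc
  -- A neighbour of c - s * t above it is w = c + 1 - (s - q) * t: outside A if q ≤ s, a neighbour
  -- of c if q > s. Neighbours below it are always neighbours of c.
  · rintro w hw (⟨h1, q, h2⟩ | ⟨h1, q, h2⟩)
    · have hq : 1 ≤ q := by
        by_contra hq
        nlinarith
      rcases lt_trichotomy q s with h3 | h3 | h3
      · refine absurd hw ?_
        have := hj (s - q) (by omega) (by omega)
        rwa [show c + 1 - (s - q) * t = w by linarith] at this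
      · refine absurd hw ?_
        rwa [show w = c + 1 by subst h3; linarith]
      · refine Or.inl ⟨?_, q - s, by linarith⟩
        nlinarith
    · exact Or.inr ⟨by omega, q + s, by linarith⟩

/-- The link of the last element `c` of `A`, and the subgraphs obtained from it by splitting off
further vertices of the last run, have the homology of a sphere. -/
theorem sphericalSplitting_link (ht : 1 ≤ t) (he : e < c - t)
    (heA : ∀ y, e - t < y → y ≤ e → y ∈ A) (i : ℕ) :
    ∀ D : Finset ℤ, (i : ℤ) < t →
      (∀ y, y ∈ D ↔ (y ∈ A ∧ y ≤ e ∧ ∃ ρ, 1 ≤ ρ ∧ ρ ≤ (i : ℤ) ∧ t ∣ c - 1 - y - ρ) ∨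
        (c - i ≤ y ∧ y < c)) →
      SphericalSplitting (stepGraph t) D ((i : ℤ) - 1) 1 := by
  classical
  induction i with
  | zero =>
    intro D _ hD
    obtain rfl : D = ∅ := by
      refine Finset.eq_empty_of_forall_notMem fun y hy => ?_
      rcases (hD y).1 hy with ⟨-, -, ρ, h1, h2, -⟩ | h
      · push_cast at h2
        omega
      · push_cast at h
        omega
    simpa using SphericalSplitting.empty (G := stepGraph t)
  | succ i ih =>
    intro D hi hD
    push_cast at hi hD ⊢
    have hz : c - (i + 1) ∈ D := (hD _).2 (Or.inr ⟨le_rfl, by omega⟩)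
    -- The t consecutive elements ending at e meet every class mod t; u is the one whose class makes
    -- it adjacent to c - (i + 1).
    obtain ⟨u, hu1, hu2, hu3⟩ : ∃ u, e - t < u ∧ u ≤ e ∧ t ∣ c - 1 - u - (i + 1) := by
      have h1 := Int.emod_nonneg (i + 1 - (c - 1 - e)) (by omega : t ≠ 0)
      have h2 := Int.emod_lt_of_pos (i + 1 - (c - 1 - e)) (by omega : 0 < t)
      refine ⟨e - (i + 1 - (c - 1 - e)) % t, by omega, by omega, ?_⟩
      have h3 := Int.dvd_self_sub_emod (x := i + 1 - (c - 1 - e)) (m := t)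
      have h4 := (Int.dvd_neg.2 h3)
      convert h4 using 1
      ring
    have huD : u ∈ D := (hD u).2 (Or.inl ⟨heA u hu1 hu2, hu2, i + 1, by omega, le_rfl, hu3⟩)
    -- The neighbours of c - (i + 1) in D form exactly the class ρ = i + 1, so its link is the set
    -- with parameter i.
    have hlink : SphericalSplitting (stepGraph t)
        (D.filter fun w => w ≠ c - (i + 1) ∧ ¬ (stepGraph t).Adj (c - (i + 1)) w) ((i : ℤ) - 1) 1 := by
      refine ih _ (by omega) fun y => ?_
      rw [Finset.mem_filter, hD]
      constructor
      · rintro ⟨⟨h1, h2, ρ, h3, h4, h5⟩ | ⟨h1, h2⟩, h6, h7⟩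
        · refine Or.inl ⟨h1, h2, ρ, h3, ?_, h5⟩
          by_contra h8
          obtain rfl : ρ = i + 1 := by omega
          exact h7 (Or.inr ⟨by omega, by convert h5 using 1; ring⟩)
        · exact Or.inr ⟨by omega, h2⟩
      · rintro (⟨h1, h2, ρ, h3, h4, h5⟩ | ⟨h1, h2⟩)
        · refine ⟨Or.inl ⟨h1, h2, ρ, h3, by omega, h5⟩, by omega, ?_⟩
          rintro (⟨h6, h7⟩ | ⟨h6, h7⟩)
          · omega
          · have h8 := Int.dvd_sub h5 h7
            have h9 := Int.eq_zero_of_abs_lt_dvd h8 (by rw [abs_lt]; omega)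
            omega
        · exact ⟨Or.inr ⟨by omega, h2⟩, by omega, stepGraph_not_adj (by omega) (by omega)⟩
    -- The vertex c - (i + 1) is the only neighbour of u: one below u would lie in the class i + 2 ≤
    -- t, which does not occur, and the other tail elements lie in the wrong classes. Thus D behaves
    -- like a suspension of the link.
    have hcone : SphericalSplitting (stepGraph t) (D.erase (c - (i + 1))) ((i : ℤ) - 1 + 1) 0 := by
      refine .cone (u := u) _ (Finset.mem_erase.2 ⟨by omega, huD⟩) fun w hw hadj => ?_
      obtain ⟨hwz, hwD⟩ := Finset.mem_erase.1 hw
      rcases hadj with ⟨h1, h2⟩ | ⟨h1, h2⟩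
      · have h3 := Int.le_of_dvd (by omega) h2
        rcases (hD w).1 hwD with ⟨-, h4, -⟩ | ⟨h4, h5⟩
        · omega
        · have h6 := Int.eq_zero_of_abs_lt_dvd (Int.dvd_sub hu3 h2) (by rw [abs_lt]; omega)
          omega
      · rcases (hD w).1 hwD with ⟨-, -, ρ, h4, h5, h6⟩ | ⟨h4, h5⟩
        · have h7 := Int.eq_zero_of_abs_lt_dvd (Int.dvd_sub h6 (Int.dvd_add hu3 h2))
            (by rw [abs_lt]; omega)
          omega
        · omega
    have := SphericalSplitting.split hz (fun w => by rw [Finset.mem_erase, and_comm])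
      (fun w => by rw [Finset.mem_filter]) hcone hlink
    convert this using 1
    ring

/-- `c` is the last element of a run of `A` of length exactly `t`. -/
def IsExactRunEnd (t : ℤ) (A : Finset ℤ) (c : ℤ) : Prop :=
  c - t ∉ A ∧ ∀ y, c - t < y → y ≤ c → y ∈ A

/-- Losing its last element turns a long run into a short one only if its length is exactly t. -/
theorem runStarts_erase_of_not_isExactRunEnd (ht : 1 ≤ t) (hc : c ∈ A) (hc1 : c + 1 ∉ A)
    (h : ¬ IsExactRunEnd t A c) : runStarts t (A.erase c) = runStarts t A := by
  ext x
  simp only [mem_runStarts, Finset.mem_erase]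
  constructor
  · rintro ⟨⟨h1, h2⟩, h3, h4⟩
    refine ⟨h2, fun h5 => h3 ⟨?_, h5⟩, fun y hy hy' => (h4 y hy hy').2⟩
    intro h6
    exact hc1 (by rwa [← h6, sub_add_cancel])
  · rintro ⟨h1, h2, h3⟩
    have key : ∀ y, x ≤ y → y < x + t → y ≠ c := by
      rintro y hy hy' rfl
      have h4 : ¬ y + 1 < x + t := fun h4 => hc1 (h3 _ (by omega) h4)
      refine h ⟨?_, fun z hz hz' => h3 z (by omega) (by omega)⟩
      rwa [show y - t = x - 1 by omega]
    exact ⟨⟨key x le_rfl (by omega), h1⟩, fun h5 => h2 h5.2,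
      fun y hy hy' => ⟨key y hy hy', h3 y hy hy'⟩⟩

/-- Take e to be the greatest element of A that is at most c - t. It ends either a run of length
exactly t or the initial block, so the t integers up to e lie in A and represent every class mod t.
-/
theorem exists_previous_run (hA : ∀ y, a ≤ y → y < a + t → y ∈ A) (hac : a + t ≤ c)
    (hct : c - t ∉ A)
    (hmin : ∀ y ∈ A, y + 1 ∉ A → a + t ≤ y → y < c → IsExactRunEnd t A y) (ht : 1 ≤ t) :
    ∃ e, a + t ≤ e + 1 ∧ e < c - t ∧ (∀ y, e - t < y → y ≤ e → y ∈ A) ∧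
      ∀ y ∈ A, y ≤ c - t → y ≤ e := by
  have hact : a + t ≤ c - t := by
    by_contra h
    exact hct (hA _ (by omega) (by omega))
  have hne : (A.filter fun y => y ≤ c - t).Nonempty :=
    ⟨a + t - 1, Finset.mem_filter.2 ⟨hA _ (by omega) (by omega), by omega⟩⟩
  obtain ⟨e, he, hmax⟩ := Finset.exists_max_image _ id hne
  obtain ⟨heA, hec⟩ := Finset.mem_filter.1 he
  have hmax' : ∀ y ∈ A, y ≤ c - t → y ≤ e := fun y h1 h2 => hmax y (Finset.mem_filter.2 ⟨h1, h2⟩)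
  have hec' : e ≠ c - t := fun h => hct (h ▸ heA)
  have hea := hmax' _ (hA (a + t - 1) (by omega) (by omega)) (by omega)
  refine ⟨e, by omega, by omega, fun y h1 h2 => ?_, hmax'⟩
  by_cases h3 : a + t ≤ e
  · refine (hmin e heA (fun h4 => ?_) h3 (by omega)).2 y h1 h2
    have := hmax' _ h4 (by omega)
    omega
  · exact hA y (by omega) (by omega)

/-- If `c` is the last element of a run of `A` which does not have length exactly `t`, and the runs
between this run and the first one have length exactly `t`, then `c` can be deleted. -/
theorem SphericalSplitting.erase_runEnd_of_not_isExactRunEnd (ht : 1 ≤ t)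
    (hA : ∀ y, a ≤ y → y < a + t → y ∈ A) (hc : c ∈ A) (hc1 : c + 1 ∉ A) (hac : a + t ≤ c)
    (hbad : ¬ IsExactRunEnd t A c)
    (hmin : ∀ y ∈ A, y + 1 ∉ A → a + t ≤ y → y < c → IsExactRunEnd t A y) {d : ℤ} {r : ℕ}
    (h : SphericalSplitting (stepGraph t) (A.erase c) d r) :
    SphericalSplitting (stepGraph t) A d r := by
  by_cases hct : c - t ∈ A
  · exact h.erase_runEnd ht hc hc1 le_rfl (by rwa [one_mul]) fun j h1 h2 => by omega
  obtain ⟨e, hae, hec, heA, hmax⟩ := exists_previous_run hA hac hct hmin ht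
  -- The partner c + q * t is the element of (e - t, e] congruent to c mod t, and s = -q.
  have h1 := Int.emod_nonneg (e - c) (by omega : t ≠ 0)
  have h2 := Int.emod_lt_of_pos (e - c) (by omega : 0 < t)
  obtain ⟨q, hq⟩ := Int.dvd_self_sub_emod (x := e - c) (m := t)
  have hq' : q < 0 := by
    by_contra h3
    nlinarith
  refine h.erase_runEnd ht hc hc1 (s := - q) (by omega) (heA _ (by linarith) (by linarith)) ?_
  intro j hj hjs hjA
  by_cases hj1 : j = 1
  · subst hj1
    rw [one_mul] at hjA
    -- the run of `c - t + 1` ends before `c`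
    have hex : (A.filter fun y => c - t < y ∧ y < c ∧ y + 1 ∉ A).Nonempty := by
      by_contra h3
      rw [Finset.not_nonempty_iff_eq_empty] at h3
      refine hbad ⟨hct, fun y h4 h5 => ?_⟩
      have key : ∀ k : ℕ, c - t + 1 + k ≤ c → c - t + 1 + k ∈ A := by
        intro k
        induction k with
        | zero => intro _; rwa [Nat.cast_zero, add_zero, show c - t + 1 = c + 1 - t by ring]
        | succ k ih =>
          intro hk
          push_cast at hk ⊢
          by_contra h6
          have : c - t + 1 + k ∈ A.filter fun y => c - t < y ∧ y < c ∧ y + 1 ∉ A :=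
            Finset.mem_filter.2 ⟨ih (by omega), by omega, by omega, by rwa [add_assoc]⟩
          simp [h3] at this
      have := key (y - (c - t + 1)).toNat (by omega)
      rwa [show c - t + 1 + ((y - (c - t + 1)).toNat : ℤ) = y by omega] at this
    obtain ⟨y, hy⟩ := hex
    obtain ⟨hyA, h3, h4, h5⟩ := Finset.mem_filter.1 hy
    exact hct ((hmin y hyA h5 (by omega) h4).2 _ (by omega) h3.le)
  -- For 2 ≤ j < s, the number c + 1 - j * t is at most c - t but exceeds e, so it falls in the gap
  -- after e.
  · have h3 : 2 * t ≤ j * t := mul_le_mul_of_nonneg_right (by omega) (by omega)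
    have h4 : j * t ≤ (-q - 1) * t := mul_le_mul_of_nonneg_right (by omega) (by omega)
    have h5 := hmax _ hjA (by linarith)
    linarith

/-- Induction on the size of A. The initial block of t elements is never touched, so each smaller
set has the same form and a supply of vertices in every class mod t. -/
theorem sphericalSplitting_of_first_run (ht : 1 ≤ t) (n : ℕ) :
    ∀ A : Finset ℤ, A.card = n → (∀ y ∈ A, a ≤ y) → (∀ y, a ≤ y → y < a + t → y ∈ A) →
      SphericalSplitting (stepGraph t) A (t - 1) ((runStarts t A).card - 1) := by
  classical
  induction n with
  | zero =>
    intro A hn _ hA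
    have := hA a le_rfl (by omega)
    rw [Finset.card_eq_zero] at hn
    simp [hn] at this
  | succ n ih =>
    intro A hn ha hA
    have haA : a ∈ A := hA a le_rfl (by omega)
    have ihe : ∀ c ∈ A, a + t ≤ c →
        SphericalSplitting (stepGraph t) (A.erase c) (t - 1) ((runStarts t (A.erase c)).card - 1) :=
      fun c hc hac => ih _ (by rw [Finset.card_erase_of_mem hc, hn, Nat.add_sub_cancel])
        (fun y hy => ha y (Finset.mem_of_mem_erase hy))
        fun y h1 h2 => Finset.mem_erase.2 ⟨by omega, hA y h1 h2⟩
    -- The smallest offending run end is the one to drop, since folding needs the runs before it to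
    -- have length exactly t.
    by_cases hbad : (A.filter fun c => c + 1 ∉ A ∧ a + t ≤ c ∧ ¬ IsExactRunEnd t A c).Nonempty
    · obtain ⟨c, hc, hmin⟩ := Finset.exists_min_image _ id hbad
      obtain ⟨hcA, hc1, hac, hc2⟩ := Finset.mem_filter.1 hc
      refine .erase_runEnd_of_not_isExactRunEnd ht hA hcA hc1 hac hc2 ?_ ?_
      · intro y h1 h2 h3 h4
        by_contra h5
        exact absurd (hmin y (Finset.mem_filter.2 ⟨h1, h2, h3, h5⟩)) (not_le.2 h4)
      · rw [← runStarts_erase_of_not_isExactRunEnd ht hcA hc1 hc2]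
        exact ihe c hcA hac
    have hgood : ∀ y ∈ A, y + 1 ∉ A → a + t ≤ y → IsExactRunEnd t A y := by
      intro y h1 h2 h3
      by_contra h4
      exact hbad ⟨y, Finset.mem_filter.2 ⟨h1, h2, h3, h4⟩⟩
    obtain ⟨c, hc, hmax⟩ := Finset.exists_max_image A id ⟨a, haA⟩
    simp only [id] at hmax
    by_cases hac : a + t ≤ c
    swap
    -- Here A is just the initial block, which is independent, so any of its vertices is a cone
    -- apex.
    · have hs : (runStarts t A).card - 1 = 0 := by
        rw [Nat.sub_eq_zero_iff_le, Finset.card_le_one]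
        have key : ∀ x ∈ runStarts t A, x = a := by
          intro x hx
          obtain ⟨h1, -, h2⟩ := mem_runStarts.1 hx
          have h3 := ha x h1
          have h4 := hmax _ (h2 (x + t - 1) (by omega) (by omega))
          omega
        exact fun x hx y hy => (key x hx).trans (key y hy).symm
      rw [hs]
      refine .cone (u := a) _ haA fun w hw => ?_
      have h1 := ha w hw
      have h2 := hmax w hw
      exact stepGraph_not_adj (by omega) (by omega)
    have hc1 : c + 1 ∉ A := fun h => by
      have := hmax _ h
      omega
    obtain ⟨hct, hcA⟩ := hgood c hc hc1 hac
    obtain ⟨e, hae, hec, heA, hemax⟩ :=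
      exists_previous_run hA hac hct (fun y h1 h2 h3 _ => hgood y h1 h2 h3) ht
    have hstarts : runStarts t (A.erase c) = (runStarts t A).erase (c - t + 1) := by
      ext x
      simp only [mem_runStarts, Finset.mem_erase]
      constructor
      · rintro ⟨⟨h1, h2⟩, h3, h4⟩
        refine ⟨?_, h2, fun h5 => h3 ⟨?_, h5⟩, fun y h5 h6 => (h4 y h5 h6).2⟩
        · rintro rfl
          exact (h4 c (by omega) (by omega)).1 rfl
        · have := hmax x h2
          omega
      · rintro ⟨h1, h2, h3, h4⟩
        have h5 := hmax _ (h4 (x + t - 1) (by omega) (by omega))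
        exact ⟨⟨by omega, h2⟩, fun h6 => h3 h6.2, fun y h6 h7 => ⟨by omega, h4 y h6 h7⟩⟩
    have hcs : c - t + 1 ∈ runStarts t A := by
      refine mem_runStarts.2 ⟨hcA _ (by omega) (by omega), ?_, fun y h1 h2 =>
        hcA y (by omega) (by omega)⟩
      rwa [add_sub_cancel_right]
    have has : a ∈ runStarts t (A.erase c) := by
      refine mem_runStarts.2 ⟨Finset.mem_erase.2 ⟨by omega, haA⟩, fun h => ?_, fun y h1 h2 =>
        Finset.mem_erase.2 ⟨by omega, hA y h1 h2⟩⟩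
      have := ha _ (Finset.mem_of_mem_erase h)
      omega
    -- The run starting at a survives the deletion, so the truncated subtraction loses nothing.
    have hcard : (runStarts t A).card - 1 = (runStarts t (A.erase c)).card - 1 + 1 := by
      have h1 := Finset.card_pos.2 ⟨a, has⟩
      have h2 := Finset.card_erase_of_mem hcs
      rw [hstarts] at h1 ⊢
      omega
    have hlink : SphericalSplitting (stepGraph t)
        (A.filter fun w => w ≠ c ∧ ¬ (stepGraph t).Adj c w) (t - 1 - 1) 1 := by
      -- The non-neighbours of c up to e are the elements with c - 1 - y nonzero mod t, i.e. the
      -- classes 1, …, t - 1; so the link of c is the case i = t - 1.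
      obtain ⟨i, rfl⟩ : ∃ i : ℕ, t = i + 1 := ⟨(t - 1).toNat, by omega⟩
      rw [add_sub_cancel_right]
      refine sphericalSplitting_link ht hec heA i _ (by omega) fun y => ?_
      rw [Finset.mem_filter]
      constructor
      · rintro ⟨h1, h2, h3⟩
        have h4 := hmax y h1
        by_cases h5 : y ≤ c - (i + 1)
        · have h8 := hemax y h1 h5
          refine Or.inl ⟨h1, h8, (c - 1 - y) % (i + 1), ?_, ?_,
            Int.dvd_self_sub_emod⟩
          · have h6 := Int.emod_nonneg (c - 1 - y) (by omega : (i + 1 : ℤ) ≠ 0)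
            by_contra h7
            refine h3 (Or.inr ⟨by omega, Int.dvd_of_emod_eq_zero ?_⟩)
            rw [show c - y - 1 = c - 1 - y by ring]
            omega
          · have h6 := Int.emod_lt_of_pos (c - 1 - y) (by omega : 0 < (i + 1 : ℤ))
            omega
        · exact Or.inr ⟨by omega, by omega⟩
      · rintro (⟨h1, h2, ρ, h3, h4, h5⟩ | ⟨h1, h2⟩)
        · refine ⟨h1, by omega, ?_⟩
          rintro (⟨h6, h7⟩ | ⟨h6, h7⟩)
          · omega
          · have := Int.eq_zero_of_abs_lt_dvd (Int.dvd_sub h7 h5) (by rw [abs_lt]; omega)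
            omega
        · exact ⟨hcA y (by omega) (by omega), by omega, stepGraph_not_adj (by omega) (by omega)⟩
    rw [hcard]
    have h1 := ihe c hc hac
    rw [show t - 1 = t - 1 - 1 + 1 by ring] at h1 ⊢
    exact .split hc (fun w => by rw [Finset.mem_erase, and_comm])
      (fun w => by rw [Finset.mem_filter]) h1 hlink

end LinearModel

/-! ### Cutting the cycle at a missing vertex -/

section CyclicModel

/-- The residue of an integer modulo `n`, as an element of `Fin n`. -/
def intResidue (n : ℕ) [NeZero n] (z : ℤ) : Fin n :=
  Fin.ofNat n (z % n).toNat

variable {n : ℕ} [NeZero n]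

theorem intCast_pos_of_neZero : (0 : ℤ) < n := by
  exact_mod_cast Nat.pos_of_ne_zero (NeZero.ne n)

theorem val_intResidue (z : ℤ) : ((intResidue n z : ℕ) : ℤ) = z % n := by
  have h1 := Int.emod_nonneg z (intCast_pos_of_neZero (n := n)).ne'
  have h2 := Int.emod_lt_of_pos z (intCast_pos_of_neZero (n := n))
  rw [intResidue, Fin.val_ofNat, Nat.mod_eq_of_lt (by omega)]
  omega

theorem intResidue_eq_iff {a b : ℤ} : intResidue n a = intResidue n b ↔ (n : ℤ) ∣ b - a := by
  rw [← Fin.val_inj, ← Int.natCast_inj, val_intResidue, val_intResidue]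
  exact Int.modEq_iff_dvd

theorem intResidue_val (v : Fin n) : intResidue n (v : ℕ) = v := by
  rw [← Fin.val_inj, ← Int.natCast_inj, val_intResidue]
  exact Int.emod_eq_of_lt (by omega) (by exact_mod_cast v.2)

theorem intResidue_eq_iff_of_abs_lt {a b : ℤ} (h : |b - a| < n) :
    intResidue n a = intResidue n b ↔ a = b := by
  rw [intResidue_eq_iff]
  constructor
  · intro h1
    have := Int.eq_zero_of_abs_lt_dvd h1 h
    omega
  · rintro rfl
    simp

theorem intResidue_val_add (z j : ℤ) :
    intResidue n ((intResidue n z : ℕ) + j) = intResidue n (z + j) := by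
  rw [intResidue_eq_iff, val_intResidue]
  convert Int.dvd_self_sub_emod (x := z) (m := n) using 1
  ring

theorem intResidue_eq_of_sub {z : ℤ} {v : Fin n} (h : (n : ℤ) ∣ v - z) : intResidue n z = v := by
  conv_rhs => rw [← intResidue_val v]
  exact intResidue_eq_iff.2 h

/-- The interval after `x` has length at least `t` if and only if the `t` vertices which follow `x`
in the cyclic order belong to `S`. -/
theorem le_card_intervalAfter_iff {S : Finset (Fin n)} {x : Fin n} (hx : x ∉ S) (t : ℕ) :
    t ≤ (intervalAfter S x).card ↔
      ∀ j : ℤ, 1 ≤ j → j ≤ t → intResidue n ((x : ℕ) + j) ∈ S := by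
  -- After n steps one is back at x ∉ S, so there is a first step d out of S, even if x is the only
  -- missing vertex. The interval is then x + 1, …, x + d - 1 modulo n.
  have hex : ∃ d : ℕ, 1 ≤ d ∧ intResidue n ((x : ℕ) + (d : ℤ)) ∉ S :=
    ⟨n, Nat.pos_of_ne_zero (NeZero.ne n), by rwa [intResidue_eq_of_sub (v := x) (by simp)]⟩
  obtain ⟨d, ⟨hd1, hdS⟩, hmin⟩ := Nat.findX hex
  have hlt : ∀ j : ℕ, 1 ≤ j → j < d → intResidue n ((x : ℕ) + (j : ℤ)) ∈ S := by
    intro j h1 h2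
    by_contra h3
    exact hmin j h2 ⟨h1, h3⟩
  have hle : ∀ j : ℕ, ∀ y : Fin n, 1 ≤ j → y ∉ S → (n : ℤ) ∣ y - ((x : ℕ) + (j : ℤ)) → d ≤ j := by
    intro j y h1 h2 h3
    by_contra h4
    have := hlt j h1 (by omega)
    rw [intResidue_eq_of_sub h3] at this
    exact h2 this
  have hdn : d ≤ n := hle n x (Nat.pos_of_ne_zero (NeZero.ne n)) hx (by simp)
  have himage : intervalAfter S x =
      (Finset.Ioo 0 d).image fun j : ℕ => intResidue n ((x : ℕ) + (j : ℤ)) := by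
    ext v
    have hv := v.2
    have hxn := x.2
    rw [Finset.mem_image]
    unfold intervalAfter
    split_ifs with hy
    · obtain ⟨y, hyS, hxy⟩ := hy
      rw [Fin.lt_def] at hxy
      have hdy : d ≤ y - x := hle (y - x) y (by omega) hyS (by
        rw [Nat.cast_sub hxy.le]
        simp)
      have hyn := y.2
      rw [Finset.mem_filter]
      constructor
      · rintro ⟨-, h1, h2⟩
        rw [Fin.lt_def] at h1
        refine ⟨v - x, ?_, intResidue_eq_of_sub ?_⟩
        · rw [Finset.mem_Ioo]
          refine ⟨by omega, ?_⟩
          by_contra h3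
          have h4 : (intResidue n ((x : ℕ) + (d : ℤ)) : ℕ) = x + d := by
            zify
            rw [val_intResidue, Int.emod_eq_of_lt (by omega) (by omega)]
          have := h2 _ hdS (by rw [Fin.lt_def]; omega)
          rw [Fin.lt_def] at this
          omega
        · rw [Nat.cast_sub h1.le]
          simp
      · rintro ⟨j, hj, rfl⟩
        rw [Finset.mem_Ioo] at hj
        have h4 : (intResidue n ((x : ℕ) + (j : ℤ)) : ℕ) = x + j := by
          zify
          rw [val_intResidue, Int.emod_eq_of_lt (by omega) (by omega)]
        refine ⟨Finset.mem_univ _, by rw [Fin.lt_def]; omega, fun z hz hxz => ?_⟩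
        rw [Fin.lt_def] at hxz ⊢
        have := hle (z - x) z (by omega) hz (by
          rw [Nat.cast_sub hxz.le]
          simp)
        omega
    · have hxy : ∀ y ∉ S, y ≤ x := fun y hyS => not_lt.1 fun h => hy ⟨y, hyS, h⟩
      have hnd : n ≤ x + d := by
        by_contra h3
        have h4 : (intResidue n ((x : ℕ) + (d : ℤ)) : ℕ) = x + d := by
          zify
          rw [val_intResidue, Int.emod_eq_of_lt (by omega) (by omega)]
        have := hxy _ hdS
        rw [Fin.le_def] at this
        omega
      rw [Finset.mem_filter]
      constructor
      · rintro ⟨-, h1 | h1⟩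
        · rw [Fin.lt_def] at h1
          refine ⟨v - x, by rw [Finset.mem_Ioo]; omega, intResidue_eq_of_sub ?_⟩
          rw [Nat.cast_sub h1.le]
          simp
        · have h2 := h1 x hx
          rw [Fin.lt_def] at h2
          refine ⟨v + n - x, ?_, intResidue_eq_of_sub ?_⟩
          · rw [Finset.mem_Ioo]
            refine ⟨by omega, ?_⟩
            by_contra h3
            have h4 : (intResidue n ((x : ℕ) + (d : ℤ)) : ℕ) = x + d - n := by
              zify [hnd]
              rw [val_intResidue, ← Int.sub_emod_right, Int.emod_eq_of_lt (by omega) (by omega)]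
            have := h1 _ hdS
            rw [Fin.lt_def] at this
            omega
          · rw [Nat.cast_sub (by omega)]
            push_cast
            exact ⟨-1, by ring⟩
      · rintro ⟨j, hj, rfl⟩
        rw [Finset.mem_Ioo] at hj
        refine ⟨Finset.mem_univ _, ?_⟩
        by_cases hjn : x + j < n
        · left
          have h4 : (intResidue n ((x : ℕ) + (j : ℤ)) : ℕ) = x + j := by
            zify
            rw [val_intResidue, Int.emod_eq_of_lt (by omega) (by omega)]
          rw [Fin.lt_def]
          omega
        · right
          intro y hyS
          have hyx := hxy y hyS
          have h4 : (intResidue n ((x : ℕ) + (j : ℤ)) : ℕ) = x + j - n := by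
            zify [not_lt.1 hjn]
            rw [val_intResidue, ← Int.sub_emod_right, Int.emod_eq_of_lt (by omega) (by omega)]
          have := hle (y + n - x) y (by omega) hyS (by
            rw [Nat.cast_sub (by omega)]
            push_cast
            exact ⟨-1, by ring⟩)
          rw [Fin.lt_def]
          omega
  rw [himage, Finset.card_image_of_injOn, Nat.card_Ioo]
  · constructor
    · intro h j h1 h2
      have := hlt j.toNat (by omega) (by omega)
      rwa [Int.toNat_of_nonneg (by omega)] at this
    · intro h
      by_contra h1
      exact hdS (h d (by omega) (by omega))
  · intro i hi j hj hij
    simp only [Finset.coe_Ioo, Set.mem_Ioo] at hi hj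
    have := (intResidue_eq_iff_of_abs_lt (by rw [abs_lt]; omega)).1 hij
    omega

open Classical in
/-- The integers `s` with `0 < s < n` for which `x + s` is in `S` modulo `n`. -/
noncomputable def cutOpen (S : Finset (Fin n)) (x : Fin n) : Finset ℤ :=
  (Finset.Ioo 0 (n : ℤ)).filter fun s => intResidue n ((x : ℕ) + s) ∈ S

theorem mem_cutOpen {S : Finset (Fin n)} {x : Fin n} {s : ℤ} :
    s ∈ cutOpen S x ↔ (0 < s ∧ s < n) ∧ intResidue n ((x : ℕ) + s) ∈ S := by
  classical
  rw [cutOpen, Finset.mem_filter, Finset.mem_Ioo]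

/-- The start s of a long run corresponds to the missing vertex x + (s - 1) just before it. No run
crosses the cut, because x itself is missing. -/
theorem numLongIntervals_eq_card_runStarts {S : Finset (Fin n)} {x : Fin n} (hx : x ∉ S) {t : ℕ}
    (ht : 1 ≤ t) : numLongIntervals t S = (runStarts t (cutOpen S x)).card := by
  have hxn : ∀ z : ℤ, (n : ℤ) ∣ z → intResidue n ((x : ℕ) + z) ∉ S := by
    intro z hz
    rwa [intResidue_eq_of_sub (v := x)]
    rw [sub_add_cancel_left]
    exact Int.dvd_neg.2 hz
  symm
  refine Finset.card_bij (fun s _ => intResidue n ((x : ℕ) + (s - 1))) ?_ ?_ ?_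
  · intro s hs
    obtain ⟨h1, h2, h3⟩ := mem_runStarts.1 hs
    rw [mem_cutOpen] at h1
    have h4 : intResidue n ((x : ℕ) + (s - 1)) ∉ S := by
      by_cases h5 : s = 1
      · subst h5
        exact hxn _ (by simp)
      · exact fun h6 => h2 (mem_cutOpen.2 ⟨by omega, h6⟩)
    rw [Finset.mem_filter, Finset.mem_compl, le_card_intervalAfter_iff h4]
    refine ⟨h4, fun j hj1 hj2 => ?_⟩
    rw [intResidue_val_add]
    have := (mem_cutOpen.1 (h3 (s - 1 + j) (by omega) (by omega))).2
    rwa [← add_assoc] at this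
  · intro s hs s' hs' h
    have h1 := (mem_cutOpen.1 (mem_runStarts.1 hs).1).1
    have h2 := (mem_cutOpen.1 (mem_runStarts.1 hs').1).1
    have := (intResidue_eq_iff_of_abs_lt (by rw [abs_lt]; omega)).1 h
    omega
  · intro y hy
    rw [Finset.mem_filter, Finset.mem_compl] at hy
    obtain ⟨hyS, hy⟩ := hy
    rw [le_card_intervalAfter_iff hyS] at hy
    obtain ⟨r, hr0, hrn, hr⟩ : ∃ r : ℤ, 0 ≤ r ∧ r < n ∧ intResidue n ((x : ℕ) + r) = y := by
      refine ⟨((y : ℕ) - (x : ℕ) : ℤ) % n, Int.emod_nonneg _ intCast_pos_of_neZero.ne',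
        Int.emod_lt_of_pos _ intCast_pos_of_neZero, intResidue_eq_of_sub ?_⟩
      rw [← sub_sub]
      exact Int.dvd_self_sub_emod
    have hshift : ∀ j : ℤ, 1 ≤ j → j ≤ t → intResidue n ((x : ℕ) + (r + j)) ∈ S := by
      intro j h1 h2
      have := hy j h1 h2
      rwa [← hr, intResidue_val_add, add_assoc] at this
    have hmem : ∀ z, r + 1 ≤ z → z < r + 1 + t → z ∈ cutOpen S x := by
      intro z h1 h2
      have hzn : z < n := by
        by_contra h3
        have := hshift (n - r) (by omega) (by omega)
        rw [add_sub_cancel] at this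
        exact hxn n dvd_rfl this
      refine mem_cutOpen.2 ⟨by omega, ?_⟩
      have := hshift (z - r) (by omega) (by omega)
      rwa [add_sub_cancel] at this
    refine ⟨r + 1, mem_runStarts.2 ⟨hmem _ le_rfl (by omega), fun h => hyS ?_, hmem⟩, ?_⟩
    · have := (mem_cutOpen.1 h).2
      rwa [add_sub_cancel_right, hr] at this
    · rw [add_sub_cancel_right, hr]

end CyclicModel

/-! ### Identification of the cut graph with the step graph -/

section GeneralizedAndrasfai

/-- The representatives of a and b differ by b - a or by b - a - n. In the second case the relevant
difference is n - (b - a), which is 1 mod t exactly when b - a is, because t divides n - 2; the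
excluded values 1 and n - 1 are exchanged. -/
theorem generalizedAndrasfaiPrime_adj_iff {t k : ℕ} (hk : 2 ≤ k) {a b : ℤ} (hab : a < b)
    (hba : b < a + ((t * (k - 1) + 2 : ℕ) : ℤ)) :
    (generalizedAndrasfaiPrime t k).Adj (intResidue _ a) (intResidue _ b) ↔
      2 ≤ b - a ∧ b - a + 2 ≤ ((t * (k - 1) + 2 : ℕ) : ℤ) ∧ (t : ℤ) ∣ b - a - 1 := by
  have hn : ((t * (k - 1) + 2 : ℕ) : ℤ) = t * (k - 1) + 2 := by
    push_cast [Nat.cast_sub (by omega : 1 ≤ k)]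
    ring
  have hdvd : (t : ℤ) ∣ ((t * (k - 1) + 2 : ℕ) : ℤ) - 2 := by
    rw [hn, add_sub_cancel_right]
    exact dvd_mul_right _ _
  have h1 := val_intResidue (n := t * (k - 1) + 2) a
  have h2 := val_intResidue (n := t * (k - 1) + 2) b
  generalize intResidue (t * (k - 1) + 2) a = u at *
  generalize intResidue (t * (k - 1) + 2) b = v at *
  have hu := u.2
  have hv := v.2
  have key : ((v : ℕ) : ℤ) - (u : ℕ) = b - a ∨
      ((v : ℕ) : ℤ) - (u : ℕ) = b - a - ((t * (k - 1) + 2 : ℕ) : ℤ) := by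
    obtain ⟨p, hp⟩ := Int.dvd_self_sub_emod (x := a) (m := ((t * (k - 1) + 2 : ℕ) : ℤ))
    obtain ⟨q, hq⟩ := Int.dvd_self_sub_emod (x := b) (m := ((t * (k - 1) + 2 : ℕ) : ℤ))
    rw [← h1] at hp
    rw [← h2] at hq
    have hu' := Int.ofNat_lt.2 hu
    have hv' := Int.ofNat_lt.2 hv
    generalize ((t * (k - 1) + 2 : ℕ) : ℤ) = N at *
    have hqp : p ≤ q := by
      by_contra h
      have : N * (q + 1) ≤ N * p := mul_le_mul_of_nonneg_left (by omega) (by omega)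
      linarith
    have hqp' : q ≤ p + 1 := by
      by_contra h
      have : N * (p + 2) ≤ N * q := mul_le_mul_of_nonneg_left (by omega) (by omega)
      linarith
    rcases (by omega : q = p ∨ q = p + 1) with rfl | rfl
    · left; linarith
    · right; linarith
  rw [generalizedAndrasfaiPrime, SimpleGraph.fromRel_adj]
  simp only [Fin.lt_def, Nat.ModEq.comm (b := 1), Nat.modEq_iff_dvd, ne_eq, ← Fin.val_inj]
  generalize t * (k - 1) + 2 = N at *
  rcases key with key | key
  · rw [Nat.cast_sub (by omega : (u : ℕ) ≤ v), key]
    constructor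
    · rintro ⟨-, ⟨h3, h4, h5, h6⟩ | ⟨h3, -⟩⟩
      · exact ⟨by omega, by omega, by exact_mod_cast h4⟩
      · omega
    · rintro ⟨h3, h4, h5⟩
      exact ⟨by omega, Or.inl ⟨by omega, by exact_mod_cast h5, by omega, by omega⟩⟩
  · have e : ((u : ℕ) : ℤ) - (v : ℕ) - 1 = (N - 2) - (b - a - 1) := by omega
    rw [Nat.cast_sub (by omega : (v : ℕ) ≤ u)]
    constructor
    · rintro ⟨-, ⟨h3, -⟩ | ⟨h3, h4, h5, h6⟩⟩
      · omega
      · rw [Nat.cast_one, e, dvd_sub_right hdvd] at h4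
        exact ⟨by omega, by omega, h4⟩
    · rintro ⟨h3, h4, h5⟩
      refine ⟨by omega, Or.inr ⟨by omega, ?_, by omega, by omega⟩⟩
      rw [Nat.cast_one, e, dvd_sub_right hdvd]
      exact h5

/-- Positions strictly between 0 and n differ by at most n - 2, so the exclusion of n - 1 is
automatic after the cut. -/
theorem generalizedAndrasfaiPrime_adj_iff_stepGraph {t k : ℕ} (hk : 2 ≤ k) (x : ℤ) {a b : ℤ}
    (ha : 0 < a ∧ a < ((t * (k - 1) + 2 : ℕ) : ℤ)) (hb : 0 < b ∧ b < ((t * (k - 1) + 2 : ℕ) : ℤ)) :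
    (generalizedAndrasfaiPrime t k).Adj (intResidue _ (x + a)) (intResidue _ (x + b)) ↔
      (stepGraph t).Adj a b := by
  have main : ∀ {a b : ℤ}, 0 < a → a < b → b < ((t * (k - 1) + 2 : ℕ) : ℤ) →
      ((generalizedAndrasfaiPrime t k).Adj (intResidue _ (x + a)) (intResidue _ (x + b)) ↔
        (stepGraph t).Adj a b) := by
    intro a b h1 h2 h3
    rw [generalizedAndrasfaiPrime_adj_iff hk (by omega) (by omega), stepGraph_adj,
      add_sub_add_left_eq_sub]
    constructor
    · exact fun h => Or.inl ⟨h.1, h.2.2⟩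
    · rintro (h | h)
      · exact ⟨h.1, by omega, h.2⟩
      · omega
  rcases lt_trichotomy a b with h | rfl | h
  · exact main ha.1 h hb.2
  · simp
  · rw [SimpleGraph.adj_comm, main hb.1 h ha.2, SimpleGraph.adj_comm]

end GeneralizedAndrasfai

/-! ### Transport to the induced subgraph -/

theorem mainTheorem6 {K : Type*} [Field K] (t k : ℕ) (ht : 1 ≤ t) (hk : 2 ≤ k)
    (S : Finset (Fin (t * (k - 1) + 2))) (hS : S ≠ Finset.univ)
    (l : ℕ) (hl : 1 ≤ l) (hlong : numLongIntervals t S = l) :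
    Nonempty
      (reducedHomology K
        (independenceComplex ((generalizedAndrasfaiPrime t k).induce
          (S : Set (Fin (t * (k - 1) + 2))))).toPreAbstractSimplicialComplex ((t : ℤ) - 1)
        ≃ₗ[K] (Fin (l - 1) → K)) ∧
    ∀ j : ℤ, j ≠ (t : ℤ) - 1 →
      Subsingleton (reducedHomology K
        (independenceComplex ((generalizedAndrasfaiPrime t k).induce
          (S : Set (Fin (t * (k - 1) + 2))))).toPreAbstractSimplicialComplex j) := by
  obtain ⟨x, hx⟩ := Finset.card_pos.1 (by rw [numLongIntervals] at hlong; omega :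
    0 < (Sᶜ.filter fun x => t ≤ (intervalAfter S x).card).card)
  rw [Finset.mem_filter, Finset.mem_compl] at hx
  obtain ⟨hxS, hx⟩ := hx
  rw [le_card_intervalAfter_iff hxS] at hx
  have hrun : ∀ y : ℤ, 1 ≤ y → y < 1 + (t : ℤ) → y ∈ cutOpen S x := by
    intro y h1 h2
    refine mem_cutOpen.2 ⟨⟨by omega, ?_⟩, hx y h1 (by omega)⟩
    have : t * 1 ≤ t * (k - 1) := Nat.mul_le_mul_left t (by omega)
    generalize t * (k - 1) = N at *
    push_cast
    omega
  have hsplit := sphericalSplitting_of_first_run (a := 1) (by omega) _ (cutOpen S x) rfl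
    (fun y hy => (mem_cutOpen.1 hy).1.1) hrun
  rw [← numLongIntervals_eq_card_runStarts hxS ht, hlong] at hsplit
  -- A retraction onto S is needed because the map from ℤ must be total; off S it takes the default
  -- value x + 1, which lies in S since the interval after x is nonempty.
  obtain ⟨g, hg⟩ : ∃ g : Fin (t * (k - 1) + 2) → (S : Set (Fin (t * (k - 1) + 2))),
      ∀ v ∈ S, (g v : Fin (t * (k - 1) + 2)) = v := by
    classical
    exact ⟨fun v => if h : v ∈ S then ⟨v, h⟩ else ⟨_, hx 1 le_rfl (by omega)⟩,
      fun v hv => by simp [hv]⟩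
  have himage := hsplit.image (H := (generalizedAndrasfaiPrime t k).induce
    (S : Set (Fin (t * (k - 1) + 2)))) (fun s => g (intResidue _ ((x : ℕ) + s)))
    (fun a ha b hb hab => by
      obtain ⟨h1, h2⟩ := mem_cutOpen.1 ha
      obtain ⟨h3, h4⟩ := mem_cutOpen.1 hb
      have h5 := congrArg Subtype.val hab
      simp only [hg _ h2, hg _ h4] at h5
      have := (intResidue_eq_iff_of_abs_lt (by rw [abs_lt]; omega)).1 h5
      omega)
    (fun a ha b hb => by
      obtain ⟨h1, h2⟩ := mem_cutOpen.1 ha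
      obtain ⟨h3, h4⟩ := mem_cutOpen.1 hb
      rw [SimpleGraph.induce_adj, hg _ h2, hg _ h4]
      exact generalizedAndrasfaiPrime_adj_iff_stepGraph hk _ h1 h3)
  have huniv : (cutOpen S x).image (fun s => g (intResidue _ ((x : ℕ) + s))) = Finset.univ := by
    refine Finset.eq_univ_of_forall fun v => Finset.mem_image.2 ?_
    have hv : v.1 ∈ S := v.2
    have hvr : intResidue _ ((x : ℕ) + ((v.1 : ℕ) - (x : ℕ) : ℤ) % (t * (k - 1) + 2 : ℕ)) = v.1 := by
      apply intResidue_eq_of_sub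
      rw [← sub_sub]
      exact Int.dvd_self_sub_emod
    refine ⟨((v.1 : ℕ) - (x : ℕ) : ℤ) % (t * (k - 1) + 2 : ℕ), mem_cutOpen.2 ⟨⟨?_, ?_⟩, ?_⟩, ?_⟩
    · refine lt_of_le_of_ne (Int.emod_nonneg _ intCast_pos_of_neZero.ne') fun h => ?_
      rw [← h, add_zero, intResidue_val] at hvr
      exact hxS (hvr ▸ hv)
    · exact Int.emod_lt_of_pos _ intCast_pos_of_neZero
    · rwa [hvr]
    · rw [hvr]
      exact Subtype.ext (hg _ hv)
  rw [huniv] at himage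
  exact (himage.homologyConcentrated K).reducedHomology
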